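/- Let $G$ be a finite simple graph. An end-vertex is a vertex of degree one. For an integer $k\ge 2$, a $k$-ended tree in $G$ is a subgraph of $G$ that is a tree with at most $k$ end-vertices; a $1$-ended tree in $G$ is a cycle of $G$, where a single vertex and a single edge count as cycles of orders $1$ and $2$. Let $t_k=t_k(G)$ be the order (number of vertices) of a largest $k$-ended tree in $G$; so $t_1$ is the circumference and $t_2$ is the order of a longest path. Let $\sigma_m=\sigma_m(G)$ be the minimum degree sum of an independent set of $m$ vertices of $G$, with $\sigma_m=+\infty$ if there is no such set. Theorem 3. Let $G$ be a connected finite simple graph and let $k,\lambda,m$ be positive integers with $m\le\min\{k,\lambda\}+1$. If $\sigma_m\ge t_{k+1}-\lambda(k-m+1)$, then $t_k\ge t_{k+1}-\lambda+1$. Moreover, this is sharp in the following sense, for all positive integers $k,\lambda,m$ with $m\le\min\{k,\lambda\}+1$. Write $pK_q+K_1$ for the graph obtained from $p$ disjoint copies of the complete graph $K_q$ by adding one vertex adjacent to all others. The connected graph $(k+1)K_\lambda+K_1$ satisfies $\sigma_m\ge t_{k+1}-\lambda(k-m+1)-1$ but not $t_k\ge t_{k+1}-\lambda+1$. If $m\le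 k$, the connected graph $(k+1)K_{\lambda-1}+K_1$ satisfies $\sigma_m\ge t_{k+1}-\lambda(k-m+1)$ but not $t_k\ge t_{k+1}-\lambda+2$. -/

import Mathlib

namespace KEndedTrees

/-- The degree of a vertex (the number of its neighbours). -/
noncomputable def deg {V : Type*} (G : SimpleGraph V) (v : V) : ℕ :=
  (G.neighborSet v).ncard

/-- `sigma G m` is the minimum of the degree sums of the independent sets of `m` vertices;
it is `⊤` (that is, `+∞`) when there is no independent set of `m` vertices. -/
noncomputable def sigma {V : Type*} (G : SimpleGraph V) (m : ℕ) : ℕ∞ :=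
  ⨅ (S : Finset V) (_ : G.IsNIndepSet m S), ((∑ v ∈ S, deg G v : ℕ) : ℕ∞)

/-- The end-vertices of a subgraph: its vertices that have degree one in it. -/
def endVertices {V : Type*} {G : SimpleGraph V} (H : G.Subgraph) : Set V :=
  {v | v ∈ H.verts ∧ (H.neighborSet v).ncard = 1}

/-- Cycles in the wide sense: a single vertex is a cycle of order 1, an edge (with its two ends)
is a cycle of order 2, and the other cycles are the usual ones, of order at least 3. -/
def IsWideCycle {V : Type*} {G : SimpleGraph V} (H : G.Subgraph) : Prop :=
  (∃ v : V, H = G.singletonSubgraph v) ∨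
  (∃ (u v : V) (h : G.Adj u v), H = G.subgraphOfAdj h) ∨
  (∃ (v : V) (c : G.Walk v v), c.IsCycle ∧ H = c.toSubgraph)

/-- `k`-ended trees in `G`: subgraphs that are trees with at most `k` end-vertices; by convention
the 1-ended trees are the cycles (in the wide sense). A tree with at most one end-vertex is a
single vertex, so for `k = 1` the first alternative adds nothing to the second. -/
def IsKEndedTree {V : Type*} {G : SimpleGraph V} (k : ℕ) (H : G.Subgraph) : Prop :=
  (H.coe.IsTree ∧ (endVertices H).ncard ≤ k) ∨ (k = 1 ∧ IsWideCycle H)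

/-- The order of a largest `k`-ended tree in `G` (for `k = 1`: the circumference of `G`). -/
noncomputable def t {V : Type*} (G : SimpleGraph V) (k : ℕ) : ℕ :=
  sSup {n : ℕ | ∃ H : G.Subgraph, IsKEndedTree k H ∧ H.verts.ncard = n}

/-- In a finite nonempty graph a largest `k`-ended tree exists and `t G k` is its order. -/
theorem t_isGreatest {V : Type*} [Finite V] [Nonempty V] (G : SimpleGraph V) (k : ℕ) :
    IsGreatest {n : ℕ | ∃ H : G.Subgraph, IsKEndedTree k H ∧ H.verts.ncard = n} (t G k) := by
  have hb : BddAbove {n : ℕ | ∃ H : G.Subgraph, IsKEndedTree k H ∧ H.verts.ncard = n} := by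
    refine ⟨Nat.card V, ?_⟩
    rintro n ⟨H, _, rfl⟩
    exact Set.ncard_le_card _
  have hne : {n : ℕ | ∃ H : G.Subgraph, IsKEndedTree k H ∧ H.verts.ncard = n}.Nonempty := by
    obtain ⟨v⟩ := ‹Nonempty V›
    refine ⟨_, G.singletonSubgraph v,
      Or.inl ⟨SimpleGraph.IsTree.coe_singletonSubgraph G v, ?_⟩, rfl⟩
    have : endVertices (G.singletonSubgraph v) = ∅ := by
      ext w
      simp [endVertices]
    simp [this]
  exact ⟨Nat.sSup_mem hne hb, fun n hn => le_csSup hb hn⟩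

/-- The join `p K_q + K_1` of one vertex (`none`) with `p` disjoint copies of the complete
graph on `q` vertices: `some (i, x)` is the vertex `x` of the copy number `i`. -/
def cliquesPlusVertex (p q : ℕ) : SimpleGraph (Option (Fin p × Fin q)) where
  Adj u v := u ≠ v ∧ ∀ a b, u = some a → v = some b → a.1 = b.1
  symm := ⟨fun _ _ h => ⟨h.1.symm, fun a b ha hb => (h.2 b a hb ha).symm⟩⟩
  loopless := ⟨fun _ h => h.1 rfl⟩

end KEndedTrees

namespace KEndedTrees

open SimpleGraph

/-! Suppose that `t G (k + 1) ≥ t G k + l` and let `T` be a largest `(k+1)`-ended tree, with vertex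
set `S`. A tree with more than `t G k` vertices cannot have `k` leaves or fewer. So every tree
obtained from `T` by losing fewer than `l` vertices and gaining no leaves has exactly `k + 1`
leaves. Moreover no two of them are adjacent in `G`: joining two leaves and deleting an edge at a
branch vertex between them would save a leaf, and a path without branch vertices would close to a
cycle, which matters for `k = 1` (`IsTreeOn.ncard_le_t_of_adj_leaves`).

This gives two kinds of bare paths. Stripping vertices from the end `u` shows that the first `l`
vertices at a leaf `u` form an unbranched tail, none of them adjacent to another leaf
(`IsTreeOn.exists_bare_path`). If a leaf `v` is adjacent to `x`, then replacing the first edge `xy`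
of the path from `x` to `v` by `xv` makes `y` a leaf instead of `v`. Hence the `l` vertices after
`x` towards `v` (or all up to `v`) are unbranched too, and adjacent to no leaf except possibly `v`
(`IsTreeOn.bare_iterate_of_adj`).

Now take a set `I` of `m` leaves, fix `v₀ ∈ I`, and let `J = I \ {v₀}`. A pair `(v, x)` with `v ∈ I`
and `x` adjacent to `v` is sent to `x` if `v = v₀`, and otherwise to the vertex reached from `x`
towards `v` in as many steps as the rank of `v` among the members of `J` in the same direction from
`x`. The rank separates leaves that share the neighbour `x` and the direction; it is at most `m - 1
≤ l`, so the move stays within the bare range. The map is injective (`IsRigid.shift_injective`) and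
misses `v₀` and the tails of the `k + 1 - m` other leaves. Hence the degree sum of the independent
set `I` is less than `t G (k + 1) - l * (k + 1 - m)` (`IsRigid.sum_deg_add_le`), a contradiction.

For sharpness, a spider spans `(k+1) K_q + K_1`, whereas a `k`-ended tree has to miss one of the
cliques or have at most `k * q + 1` vertices anyway. -/

/-- `T` is a tree with vertex set `S`, considered as a graph on the ambient vertex type. -/
structure IsTreeOn {V : Type*} (T : SimpleGraph V) (S : Set V) : Prop where
  nonempty : S.Nonempty
  mem : ∀ ⦃x y⦄, T.Adj x y → x ∈ S
  acyclic : T.IsAcyclic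
  reach : ∀ ⦃x⦄, x ∈ S → ∀ ⦃y⦄, y ∈ S → T.Reachable x y

/-- The vertices of degree one. -/
def leaves {V : Type*} (T : SimpleGraph V) : Set V := {v | deg T v = 1}

open Classical in
/-- The neighbour of `x` that is closer to `v` (in a tree, for `x ≠ v`); `x` if there is none. -/
noncomputable def nxt {V : Type*} (T : SimpleGraph V) (x v : V) : V :=
  if h : ∃ a, T.Adj x a ∧ T.dist a v < T.dist x v then h.choose else x

/-! ### Directions and distances in a tree -/

section General

variable {V : Type*} {T : SimpleGraph V} {S : Set V}

lemma exists_adj_dist_lt {x v : V} (h : T.Reachable x v) (hne : x ≠ v) :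
    ∃ a, T.Adj x a ∧ T.dist a v < T.dist x v := by
  obtain ⟨p, hp⟩ := h.exists_walk_length_eq_dist
  cases p with
  | nil => exact absurd rfl hne
  | cons ha q =>
    refine ⟨_, ha, ?_⟩
    have := dist_le q
    simp only [Walk.length_cons] at hp
    omega

lemma nxt_self (v : V) : nxt T v v = v := by
  unfold nxt
  simp

lemma nxt_spec {x v : V} (h : T.Reachable x v) (hne : x ≠ v) :
    T.Adj x (nxt T x v) ∧ T.dist (nxt T x v) v < T.dist x v := by
  have := exists_adj_dist_lt h hne
  unfold nxt
  rw [dif_pos this]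
  exact this.choose_spec

/-- A path that descends from `z` to `v` never meets `x`: it starts off `x`, and after one step it
is strictly nearer to `v` than `x` is. -/
lemma reachable_deleteEdges_of_dist_le {x v a : V} :
    ∀ (n : ℕ) (z : V), T.dist z v = n → T.Reachable z v → z ≠ x → T.dist z v ≤ T.dist x v →
      (T.deleteEdges {s(x, a)}).Reachable z v := by
  intro n
  induction n using Nat.strong_induction_on with
  | _ n ih =>
    intro z hz hr hzx hle
    by_cases hzv : z = v
    · subst hzv; rfl
    obtain ⟨b, hb, hlt⟩ := exists_adj_dist_lt hr hzv
    have hbx : b ≠ x := by rintro rfl; omega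
    have h1 := ih _ (hz ▸ hlt) b rfl (hb.symm.reachable.trans hr) hbx (by omega)
    refine Reachable.trans (Adj.reachable ?_) h1
    rw [deleteEdges_adj]
    refine ⟨hb, ?_⟩
    simp only [Set.mem_singleton_iff, Sym2.eq_iff]
    rintro (⟨h, -⟩ | ⟨-, h⟩)
    · exact hzx h
    · exact hbx h

lemma IsTreeOn.mem_right (hT : IsTreeOn T S) {x y : V} (h : T.Adj x y) : y ∈ S := hT.mem h.symm

lemma IsTreeOn.dist_ne (hT : IsTreeOn T S) {x a v : V} (h : T.Adj x a) (hv : v ∈ S) :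
    T.dist x v ≠ T.dist a v := by
  rw [dist_comm (u := x), dist_comm (u := a)]
  exact hT.acyclic.dist_ne_of_adj h (hT.reach hv (hT.mem h))

/-- Two neighbours of `x` nearer to `v` would be joined through `v` without the edge `xa`, which
would then not be a bridge. -/
lemma IsTreeOn.eq_of_dist_lt (hT : IsTreeOn T S) {x a b v : V} (ha : T.Adj x a) (hb : T.Adj x b)
    (hv : v ∈ S) (hav : T.dist a v < T.dist x v) (hbv : T.dist b v < T.dist x v) : a = b := by
  by_contra hab
  have h1 := reachable_deleteEdges_of_dist_le (T := T) (x := x) (v := v) (a := a) _ a rfl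
    (hT.reach (hT.mem_right ha) hv) ha.ne.symm hav.le
  have h2 := reachable_deleteEdges_of_dist_le (T := T) (x := x) (v := v) (a := a) _ b rfl
    (hT.reach (hT.mem_right hb) hv) hb.ne.symm hbv.le
  have h3 : (T.deleteEdges {s(x, a)}).Adj x b := by
    rw [deleteEdges_adj]
    refine ⟨hb, ?_⟩
    simp only [Set.mem_singleton_iff, Sym2.eq_iff]
    rintro (⟨-, h⟩ | ⟨h, -⟩)
    · exact hab h.symm
    · exact ha.ne h
  exact isBridge_iff.1 (isAcyclic_iff_forall_adj_isBridge.1 hT.acyclic ha)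
    (h3.reachable.trans (h2.trans h1.symm))

lemma IsTreeOn.adj_nxt (hT : IsTreeOn T S) {x v : V} (hx : x ∈ S) (hv : v ∈ S) (h : x ≠ v) :
    T.Adj x (nxt T x v) := (nxt_spec (hT.reach hx hv) h).1

lemma IsTreeOn.dist_nxt (hT : IsTreeOn T S) {x v : V} (hx : x ∈ S) (hv : v ∈ S) (h : x ≠ v) :
    T.dist (nxt T x v) v < T.dist x v := (nxt_spec (hT.reach hx hv) h).2

lemma IsTreeOn.nxt_eq_of_dist_lt (hT : IsTreeOn T S) {x v a : V} (hv : v ∈ S) (ha : T.Adj x a)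
    (hlt : T.dist a v < T.dist x v) : nxt T x v = a := by
  have hne : x ≠ v := by rintro rfl; simp at hlt
  exact hT.eq_of_dist_lt (hT.adj_nxt (hT.mem ha) hv hne) ha hv
    (hT.dist_nxt (hT.mem ha) hv hne) hlt

lemma IsTreeOn.nxt_eq_or (hT : IsTreeOn T S) {x a v : V} (hv : v ∈ S) (ha : T.Adj x a) :
    nxt T x v = a ∨ nxt T a v = x := by
  rcases lt_or_gt_of_ne (hT.dist_ne ha hv) with h | h
  · exact Or.inr (hT.nxt_eq_of_dist_lt hv ha.symm h)
  · exact Or.inl (hT.nxt_eq_of_dist_lt hv ha h)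

lemma IsTreeOn.dist_lt_of_nxt_eq (hT : IsTreeOn T S) {x a v : V} (hv : v ∈ S) (ha : T.Adj x a)
    (h : nxt T x v = a) : T.dist a v < T.dist x v := by
  by_cases hne : x = v
  · subst hne
    rw [nxt_self] at h
    exact absurd h ha.ne
  · rw [← h]
    exact hT.dist_nxt (hT.mem ha) hv hne

lemma IsTreeOn.not_nxt_eq_and (hT : IsTreeOn T S) {x a v : V} (hv : v ∈ S) (ha : T.Adj x a)
    (h : nxt T x v = a) : nxt T a v ≠ x := fun h' => by
  have h1 := hT.dist_lt_of_nxt_eq hv ha h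
  have h2 := hT.dist_lt_of_nxt_eq hv ha.symm h'
  omega

lemma IsTreeOn.nxt_mem (hT : IsTreeOn T S) {x v : V} (hx : x ∈ S) (hv : v ∈ S) :
    nxt T x v ∈ S := by
  by_cases h : x = v
  · subst h; rwa [nxt_self]
  · exact hT.mem_right (hT.adj_nxt hx hv h)

lemma IsTreeOn.iterate_nxt_mem (hT : IsTreeOn T S) {x v : V} (hx : x ∈ S) (hv : v ∈ S) (n : ℕ) :
    (fun z => nxt T z v)^[n] x ∈ S := by
  induction n with
  | zero => exact hx
  | succ n ih => rw [Function.iterate_succ_apply']; exact hT.nxt_mem ih hv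

lemma subset_of_adj_closed (hT : IsTreeOn T S) {P : Set V} {x : V} (hx : x ∈ S) (hxP : x ∈ P)
    (hP : ∀ a ∈ P, ∀ b, T.Adj a b → b ∈ P) : S ⊆ P := by
  intro y hy
  have h := (reachable_iff_reflTransGen x y).1 (hT.reach hx hy)
  induction h with
  | refl => exact hxP
  | @tail b c hb hc ih => exact hP b (ih (hT.mem hc)) c hc

end General

/-! ### Leaves and vertices of degree two -/

section Degree

variable {V : Type*} {T : SimpleGraph V}

lemma deg_eq_one_iff {v : V} : deg T v = 1 ↔ ∃ a, ∀ b, T.Adj v b ↔ b = a := by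
  unfold deg
  rw [Set.ncard_eq_one]
  simp [Set.ext_iff]

lemma eq_of_mem_leaves {v a b : V} (hv : v ∈ leaves T) (ha : T.Adj v a) (hb : T.Adj v b) :
    a = b := by
  obtain ⟨c, hc⟩ := deg_eq_one_iff.1 hv
  rw [(hc a).1 ha, (hc b).1 hb]

lemma exists_adj_of_mem_leaves {v : V} (hv : v ∈ leaves T) : ∃ a, T.Adj v a := by
  obtain ⟨c, hc⟩ := deg_eq_one_iff.1 hv
  exact ⟨c, (hc c).2 rfl⟩

lemma mem_leaves_of {v a : V} (ha : T.Adj v a) (h : ∀ b, T.Adj v b → b = a) : v ∈ leaves T :=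
  deg_eq_one_iff.2 ⟨a, fun b => ⟨h b, fun hb => hb ▸ ha⟩⟩

lemma IsTreeOn.leaves_subset {S : Set V} (hT : IsTreeOn T S) : leaves T ⊆ S := fun _ hv =>
  let ⟨_, ha⟩ := exists_adj_of_mem_leaves hv
  hT.mem ha

lemma not_mem_leaves_of {z p q : V} (hp : T.Adj z p) (hq : T.Adj z q) (hpq : p ≠ q) :
    z ∉ leaves T := fun h => hpq (eq_of_mem_leaves h hp hq)

variable [Finite V]

lemma eq_or_eq_of_deg_le_two {z p q r : V} (hz : deg T z ≤ 2) (hp : T.Adj z p) (hq : T.Adj z q)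
    (hpq : p ≠ q) (hr : T.Adj z r) : r = p ∨ r = q := by
  by_contra! h
  have : ({p, q, r} : Set V) ⊆ T.neighborSet z := by
    intro x hx
    simp only [Set.mem_insert_iff, Set.mem_singleton_iff] at hx
    rcases hx with rfl | rfl | rfl <;> assumption
  have h1 := Set.ncard_le_ncard this (Set.toFinite _)
  have h2 : ({p, q, r} : Set V).ncard = 3 := by
    rw [Set.ncard_eq_three]
    exact ⟨p, q, r, hpq, h.1.symm, h.2.symm, rfl⟩
  unfold deg at hz
  omega

lemma deg_le_two_of {z p q : V} (h : ∀ r, T.Adj z r → r = p ∨ r = q) : deg T z ≤ 2 := by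
  have : T.neighborSet z ⊆ {p, q} := fun r hr => h r hr
  refine (Set.ncard_le_ncard this (Set.toFinite _)).trans ((Set.ncard_insert_le p {q}).trans ?_)
  rw [Set.ncard_singleton]

lemma exists_adj_ne_ne {z : V} (h : 2 < deg T z) (p q : V) :
    ∃ r, T.Adj z r ∧ r ≠ p ∧ r ≠ q := by
  by_contra! hc
  have := deg_le_two_of (T := T) (z := z) (p := p) (q := q) (fun r hr => by
    by_cases h1 : r = p
    · exact Or.inl h1
    · exact Or.inr (hc r hr h1))
  omega

lemma exists_adj_ne {z : V} (h : 1 < deg T z) (p : V) :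
    ∃ r, T.Adj z r ∧ r ≠ p := by
  by_contra! hc
  have : T.neighborSet z ⊆ {p} := fun r hr => hc r hr
  have := Set.ncard_le_ncard this (Set.toFinite _)
  rw [Set.ncard_singleton] at this
  unfold deg at h
  omega

lemma deg_pos {z a : V} (h : T.Adj z a) : 0 < deg T z := by
  unfold deg
  exact (Set.ncard_pos (Set.toFinite _)).2 ⟨a, h⟩

end Degree

/-! ### Exchanging, removing and adding edges of a tree -/

section Surgery

variable {V : Type*} {T : SimpleGraph V} {S : Set V}

/-- `T` with the edge `ab` replaced by the edge `uv`. -/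
def swap (T : SimpleGraph V) (a b u v : V) : SimpleGraph V :=
  T.deleteEdges {s(a, b)} ⊔ edge u v

lemma swap_adj {a b u v p q : V} (huv : u ≠ v) : (swap T a b u v).Adj p q ↔
    (T.Adj p q ∧ ¬ (p = a ∧ q = b) ∧ ¬ (p = b ∧ q = a)) ∨ (p = u ∧ q = v) ∨ (p = v ∧ q = u) := by
  unfold swap
  rw [sup_adj, deleteEdges_adj, edge_adj]
  simp only [Set.mem_singleton_iff, Sym2.eq_iff]
  constructor
  · rintro (⟨h1, h2⟩ | ⟨h, -⟩)
    · exact Or.inl ⟨h1, fun h => h2 (Or.inl h), fun h => h2 (Or.inr h)⟩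
    · exact Or.inr h
  · rintro (⟨h1, h2, h3⟩ | h)
    · exact Or.inl ⟨h1, fun h => h.elim h2 h3⟩
    · refine Or.inr ⟨h, ?_⟩
      rcases h with ⟨rfl, rfl⟩ | ⟨rfl, rfl⟩
      · exact huv
      · exact huv.symm

/-- The distance conditions say that `u` lies on the side of `a` and `v` on the side of `b` once
`ab` is deleted, so `uv` reconnects the two components. -/
lemma IsTreeOn.isTreeOn_swap (hT : IsTreeOn T S) {a b u v : V} (hab : T.Adj a b) (hu : u ∈ S) (hv : v ∈ S)
    (hua : T.dist a u < T.dist b u) (hvb : T.dist b v < T.dist a v) :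
    IsTreeOn (swap T a b u v) S := by
  have huv : u ≠ v := by rintro rfl; omega
  have ha := hT.mem hab
  have hb := hT.mem_right hab
  have h1 := reachable_deleteEdges_of_dist_le (T := T) (x := b) (v := u) (a := a) _ a rfl
    (hT.reach ha hu) hab.ne hua.le
  rw [Sym2.eq_swap] at h1
  have h2 := reachable_deleteEdges_of_dist_le (T := T) (x := a) (v := v) (a := b) _ b rfl
    (hT.reach hb hv) hab.ne.symm hvb.le
  have hbr := isBridge_iff.1 (isAcyclic_iff_forall_adj_isBridge.1 hT.acyclic hab)
  have hle : T.deleteEdges {s(a, b)} ≤ swap T a b u v := le_sup_left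
  have key : ∀ z ∈ S, (swap T a b u v).Reachable z u := by
    intro z hz
    have hadj : (swap T a b u v).Adj v u :=
      (swap_adj huv).2 (Or.inr (Or.inr ⟨rfl, rfl⟩))
    rcases lt_or_gt_of_ne (hT.dist_ne hab hz) with h | h
    · have h3 := reachable_deleteEdges_of_dist_le (T := T) (x := b) (v := z) (a := a) _ a rfl
        (hT.reach ha hz) hab.ne h.le
      rw [Sym2.eq_swap] at h3
      exact (h3.symm.trans h1).mono hle
    · have h3 := reachable_deleteEdges_of_dist_le (T := T) (x := a) (v := z) (a := b) _ b rfl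
        (hT.reach hb hz) hab.ne.symm h.le
      exact ((h3.symm.trans h2).mono hle).trans hadj.reachable
  refine ⟨hT.nonempty, ?_, ?_, fun x hx y hy => (key x hx).trans (key y hy).symm⟩
  · intro x y h
    rcases (swap_adj huv).1 h with h | h | h
    · exact hT.mem h.1
    · exact h.1 ▸ hu
    · exact h.1 ▸ hv
  · exact IsAcyclic.sup_edge_of_not_reachable
      (fun h => hbr (h1.trans (h.trans h2.symm))) (hT.acyclic.anti (deleteEdges_le _))

lemma swap_le {G : SimpleGraph V} (hTG : T ≤ G) {a b u v : V} (huv : G.Adj u v) :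
    swap T a b u v ≤ G := by
  intro p q h
  rcases (swap_adj huv.ne).1 h with h | ⟨rfl, rfl⟩ | ⟨rfl, rfl⟩
  · exact hTG h.1
  · exact huv
  · exact huv.symm

/-- `T` with the vertex `u` made isolated. -/
def isolate (T : SimpleGraph V) (u : V) : SimpleGraph V := T.deleteEdges {e | u ∈ e}

lemma isolate_adj {u p q : V} : (isolate T u).Adj p q ↔ T.Adj p q ∧ p ≠ u ∧ q ≠ u := by
  unfold isolate
  rw [deleteEdges_adj]
  simp only [Set.mem_ofPred_eq, Sym2.mem_iff, not_or, ne_eq, eq_comm (a := u)]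

lemma isolate_le {u : V} : isolate T u ≤ T := deleteEdges_le _

lemma IsTreeOn.isTreeOn_isolate (hT : IsTreeOn T S) {u u' : V} (hu : u ∈ leaves T)
    (hadj : T.Adj u u') : IsTreeOn (isolate T u) (S \ {u}) := by
  have heq : isolate T u = T.deleteEdges {s(u, u')} := by
    ext p q
    rw [isolate_adj, deleteEdges_adj]
    simp only [Set.mem_singleton_iff, Sym2.eq_iff]
    refine and_congr_right fun h => ⟨?_, fun h' => ⟨?_, ?_⟩⟩
    · rintro ⟨h1, h2⟩ (⟨h3, -⟩ | ⟨-, h3⟩)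
      · exact h1 h3
      · exact h2 h3
    · rintro rfl
      exact h' (Or.inl ⟨rfl, eq_of_mem_leaves hu h hadj⟩)
    · rintro rfl
      exact h' (Or.inr ⟨eq_of_mem_leaves hu h.symm hadj, rfl⟩)
  have key : ∀ z ∈ S \ {u}, (isolate T u).Reachable u' z := by
    intro z hz
    rw [heq]
    have hne : u ≠ z := fun h => hz.2 h.symm
    have h1 : nxt T u z = u' :=
      eq_of_mem_leaves hu (hT.adj_nxt (hT.mem hadj) hz.1 hne) hadj
    exact reachable_deleteEdges_of_dist_le _ u' rfl (hT.reach (hT.mem_right hadj) hz.1)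
      hadj.ne.symm (hT.dist_lt_of_nxt_eq hz.1 hadj h1).le
  refine ⟨⟨u', hT.mem_right hadj, hadj.ne.symm⟩, fun x y h => ?_, hT.acyclic.anti isolate_le,
    fun x hx y hy => (key x hx).symm.trans (key y hy)⟩
  rw [isolate_adj] at h
  exact ⟨hT.mem h.1, h.2.1⟩

/-- `T` with the new edge `vw`. -/
def addEdge (T : SimpleGraph V) (v w : V) : SimpleGraph V := T ⊔ edge v w

lemma addEdge_adj {v w p q : V} (hvw : v ≠ w) : (addEdge T v w).Adj p q ↔
    T.Adj p q ∨ (p = v ∧ q = w) ∨ (p = w ∧ q = v) := by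
  unfold addEdge
  rw [sup_adj, edge_adj]
  refine or_congr Iff.rfl ⟨fun h => h.1, fun h => ⟨h, ?_⟩⟩
  rcases h with ⟨rfl, rfl⟩ | ⟨rfl, rfl⟩
  · exact hvw
  · exact hvw.symm

lemma IsTreeOn.isTreeOn_addEdge (hT : IsTreeOn T S) {v w : V} (hv : v ∈ S) (hw : w ∉ S) :
    IsTreeOn (addEdge T v w) (insert w S) := by
  have hvw : v ≠ w := by rintro rfl; exact hw hv
  have hadj : (addEdge T v w).Adj w v :=
    (addEdge_adj hvw).2 (Or.inr (Or.inr ⟨rfl, rfl⟩))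
  have key : ∀ z ∈ insert w S, (addEdge T v w).Reachable z v := by
    rintro z (rfl | hz)
    · exact hadj.reachable
    · exact (hT.reach hz hv).mono le_sup_left
  refine ⟨⟨w, Or.inl rfl⟩, fun x y h => ?_, ?_, fun x hx y hy => (key x hx).trans (key y hy).symm⟩
  · rcases (addEdge_adj hvw).1 h with h | ⟨rfl, -⟩ | ⟨rfl, -⟩
    · exact Or.inr (hT.mem h)
    · exact Or.inr hv
    · exact Or.inl rfl
  · refine IsAcyclic.sup_edge_of_not_reachable (fun h => hw ?_) hT.acyclic
    exact hT.mem (nxt_spec h.symm hvw.symm).1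

lemma addEdge_le {G : SimpleGraph V} (hTG : T ≤ G) {v w : V} (h : G.Adj v w) :
    addEdge T v w ≤ G := by
  intro p q hpq
  rcases (addEdge_adj h.ne).1 hpq with h' | ⟨rfl, rfl⟩ | ⟨rfl, rfl⟩
  · exact hTG h'
  · exact h
  · exact h.symm

lemma mem_leaves_congr {T' : SimpleGraph V} {z : V} (h : ∀ q, T'.Adj z q ↔ T.Adj z q) :
    z ∈ leaves T' ↔ z ∈ leaves T := by
  have : T'.neighborSet z = T.neighborSet z := by ext q; exact h q
  simp only [leaves, deg, Set.mem_ofPred_eq, this]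

lemma mem_leaves_swap_iff {x y v z : V} (hxv : x ≠ v) (hzx : z ≠ x) (hzy : z ≠ y) (hzv : z ≠ v) :
    z ∈ leaves (swap T x y x v) ↔ z ∈ leaves T := by
  refine mem_leaves_congr fun q => ?_
  rw [swap_adj hxv]
  simp [hzx, hzy, hzv]

lemma not_mem_leaves_isolate {u u' : V} (hu' : deg T u' ≠ 2) (hadj : T.Adj u u') :
    u' ∉ leaves (isolate T u) := by
  intro h
  obtain ⟨a, ha⟩ := deg_eq_one_iff.1 h
  apply hu'
  have : T.neighborSet u' = {u, a} := by
    ext q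
    have := ha q
    rw [isolate_adj] at this
    simp only [mem_neighborSet, Set.mem_insert_iff, Set.mem_singleton_iff, ← this]
    constructor
    · intro h
      by_cases hq : q = u
      · exact Or.inl hq
      · exact Or.inr ⟨h, hadj.ne.symm, hq⟩
    · rintro (rfl | h)
      · exact hadj.symm
      · exact h.1
  unfold deg
  rw [this, Set.ncard_pair]
  rintro rfl
  exact (isolate_adj.1 ((ha u).2 rfl)).2.2 rfl

lemma leaves_addEdge_subset (hT : IsTreeOn T S) {v w : V} (hv : v ∈ leaves T) (hw : w ∉ S) :
    leaves (addEdge T v w) ⊆ insert w (leaves T \ {v}) := by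
  intro z hz
  have hvw : v ≠ w := by rintro rfl; exact hw (hT.leaves_subset hv)
  by_cases hzw : z = w
  · exact Or.inl hzw
  have hzv : z ≠ v := by
    rintro rfl
    obtain ⟨a, ha⟩ := exists_adj_of_mem_leaves hv
    refine not_mem_leaves_of (p := a) (q := w) ((addEdge_adj hvw).2 (Or.inl ha))
      ((addEdge_adj hvw).2 (Or.inr (Or.inl ⟨rfl, rfl⟩))) ?_ hz
    rintro rfl
    exact hw (hT.mem_right ha)
  refine Or.inr ⟨?_, hzv⟩
  refine (mem_leaves_congr fun q => ?_).1 hz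
  rw [addEdge_adj hvw]
  simp [hzv, hzw]

lemma leaves_isolate_subset {u u' : V} (hu : u ∈ leaves T) (hadj : T.Adj u u') :
    leaves (isolate T u) ⊆ insert u' (leaves T \ {u}) := by
  intro z hz
  by_cases hzu' : z = u'
  · exact Or.inl hzu'
  have hzu : z ≠ u := by
    rintro rfl
    obtain ⟨a, ha⟩ := exists_adj_of_mem_leaves hz
    exact (isolate_adj.1 ha).2.1 rfl
  refine Or.inr ⟨(mem_leaves_congr fun q => ?_).1 hz, hzu⟩
  rw [isolate_adj]
  refine ⟨fun h => h.1, fun h => ⟨h, hzu, ?_⟩⟩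
  rintro rfl
  exact hzu' (eq_of_mem_leaves hu h.symm hadj)

variable [Finite V]

/-- Both `u` and `v` gain an edge and `b` keeps at least two, so only `a`, which may coincide with
`u`, can be a leaf outside the old leaves other than `u` and `v`. -/
lemma leaves_swap_subset {a b u v : V} (hb : 2 < deg T b)
    (hu : u ∈ leaves T) (hv : v ∈ leaves T) (huv : u ≠ v) (hva : v ≠ a) (hnadj : ¬ T.Adj u v) :
    leaves (swap T a b u v) ⊆ insert a (leaves T \ {u, v}) := by
  intro z hz
  by_cases hza : z = a
  · exact Or.inl hza
  have hub : u ≠ b := by rintro rfl; have : deg T u = 1 := hu; omega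
  have hvb : v ≠ b := by rintro rfl; have : deg T v = 1 := hv; omega
  have hzb : z ≠ b := by
    rintro rfl
    obtain ⟨p, hp, hpa, -⟩ := exists_adj_ne_ne hb a a
    obtain ⟨q, hq, hqa, hqp⟩ := exists_adj_ne_ne hb a p
    refine not_mem_leaves_of (p := p) (q := q) ((swap_adj huv).2 (Or.inl ⟨hp, ?_⟩))
      ((swap_adj huv).2 (Or.inl ⟨hq, ?_⟩)) hqp.symm hz <;> simp [hza, hpa, hqa]
  have hzv : z ≠ v := by
    rintro rfl
    obtain ⟨p, hp⟩ := exists_adj_of_mem_leaves hv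
    refine not_mem_leaves_of (p := p) (q := u) ((swap_adj huv).2 (Or.inl ⟨hp, ?_⟩))
      ((swap_adj huv).2 (Or.inr (Or.inr ⟨rfl, rfl⟩))) ?_ hz
    · simp [hza, hzb]
    · rintro rfl
      exact hnadj hp.symm
  have hzu : z ≠ u := by
    rintro rfl
    obtain ⟨p, hp⟩ := exists_adj_of_mem_leaves hu
    refine not_mem_leaves_of (p := p) (q := v) ((swap_adj huv).2 (Or.inl ⟨hp, ?_⟩))
      ((swap_adj huv).2 (Or.inr (Or.inl ⟨rfl, rfl⟩))) ?_ hz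
    · simp [hza, hzb]
    · rintro rfl
      exact hnadj hp
  refine Or.inr ⟨?_, by simp [hzu, hzv]⟩
  refine (mem_leaves_congr fun q => ?_).1 hz
  rw [swap_adj huv]
  simp [hza, hzb, hzu, hzv]

/-- The leaf `v` gains the neighbour `x`, and `x` trades `y` for `v`; only `y` loses a degree. -/
lemma leaves_swap_subset' {x y v : V} (hx : x ∉ leaves T)
    (hxy : T.Adj x y) (hv : v ∈ leaves T) (hyv : y ≠ v) (hnadj : ¬ T.Adj x v) :
    leaves (swap T x y x v) ⊆ insert y (leaves T \ {v}) := by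
  intro z hz
  have hxv : x ≠ v := by rintro rfl; exact hx hv
  by_cases hzy : z = y
  · exact Or.inl hzy
  have hzx : z ≠ x := by
    rintro rfl
    have hd := deg_pos hxy
    have hd' : deg T z ≠ 1 := hx
    obtain ⟨p, hp, hpy⟩ := exists_adj_ne (T := T) (z := z) (by omega) y
    refine not_mem_leaves_of (p := p) (q := v) ((swap_adj hxv).2 (Or.inl ⟨hp, ?_⟩))
      ((swap_adj hxv).2 (Or.inr (Or.inl ⟨rfl, rfl⟩))) ?_ hz
    · simp [hpy, hzy]
    · rintro rfl
      exact hnadj hp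
  have hzv : z ≠ v := by
    rintro rfl
    obtain ⟨p, hp⟩ := exists_adj_of_mem_leaves hv
    refine not_mem_leaves_of (p := p) (q := x) ((swap_adj hxv).2 (Or.inl ⟨hp, ?_⟩))
      ((swap_adj hxv).2 (Or.inr (Or.inr ⟨rfl, rfl⟩))) ?_ hz
    · simp [hzx, hzy]
    · rintro rfl
      exact hnadj hp.symm
  exact Or.inr ⟨(mem_leaves_swap_iff hxv hzx hzy hzv).1 hz, hzv⟩

lemma not_mem_leaves_swap {x y v : V} (hxy : T.Adj x y) (hxv : x ≠ v)
    (hy : 2 < deg T y) : y ∉ leaves (swap T x y x v) := by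
  obtain ⟨p, hp, hpx, -⟩ := exists_adj_ne_ne hy x x
  obtain ⟨q, hq, hqx, hqp⟩ := exists_adj_ne_ne hy x p
  refine not_mem_leaves_of (p := p) (q := q) ((swap_adj hxv).2 (Or.inl ⟨hp, ?_⟩))
      ((swap_adj hxv).2 (Or.inl ⟨hq, ?_⟩)) hqp.symm <;> simp [hpx, hqx, hxy.ne.symm]

lemma mem_leaves_swap {x y v c : V} (hxy : T.Adj x y) (hxv : x ≠ v) (hyv : y ≠ v)
    (hyc : T.Adj y c) (hcx : c ≠ x)
    (hy : deg T y ≤ 2) : y ∈ leaves (swap T x y x v) := by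
  refine mem_leaves_of (a := c) ((swap_adj hxv).2 (Or.inl ⟨hyc, by simp [hxy.ne.symm], by simp [hcx]⟩)) ?_
  intro q hq
  rcases (swap_adj hxv).1 hq with ⟨h, -, h2⟩ | ⟨h, -⟩ | ⟨h, -⟩
  · rcases eq_or_eq_of_deg_le_two hy hxy.symm hyc hcx.symm h with h3 | h3
    · exact absurd ⟨rfl, h3⟩ h2
    · exact h3
  · exact absurd h hxy.ne.symm
  · exact absurd h hyv

end Surgery

/-! ### Passing between subgraphs and graphs on the ambient vertex type -/

section Convert

variable {V : Type*} {G T : SimpleGraph V} {S : Set V}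

/-- A tree contained in `G`, as a subgraph of `G`. -/
def IsTreeOn.toSubgraph (hT : IsTreeOn T S) (hTG : T ≤ G) : G.Subgraph where
  verts := S
  Adj := T.Adj
  adj_sub h := hTG h
  edge_vert h := hT.mem h
  symm := ⟨fun _ _ h => h.symm⟩

lemma IsTreeOn.isTree_coe_toSubgraph (hT : IsTreeOn T S) (hTG : T ≤ G) :
    (hT.toSubgraph hTG).coe.IsTree := by
  have key : ∀ (x y : V), T.Reachable x y → ∀ hx : x ∈ S, ∃ hy : y ∈ S,
      (hT.toSubgraph hTG).coe.Reachable ⟨x, hx⟩ ⟨y, hy⟩ := by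
    intro x y h hx
    rw [reachable_iff_reflTransGen] at h
    induction h with
    | refl => exact ⟨hx, Reachable.refl _⟩
    | tail _ hbc ih =>
      obtain ⟨hb, h⟩ := ih
      refine ⟨hT.mem_right hbc, h.trans (Adj.reachable ?_)⟩
      exact hbc
  constructor
  · have : Nonempty (hT.toSubgraph hTG).verts := hT.nonempty.to_subtype
    exact ⟨fun x y => (key x y (hT.reach x.2 y.2) x.2).2⟩
  · exact hT.acyclic.comap ⟨fun x => x.1, fun h => h⟩ Subtype.val_injective

lemma IsTreeOn.endVertices_toSubgraph (hT : IsTreeOn T S) (hTG : T ≤ G) :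
    endVertices (hT.toSubgraph hTG) = leaves T := by
  ext v
  exact ⟨fun h => h.2, fun h => ⟨hT.leaves_subset h, h⟩⟩

lemma isTreeOn_spanningCoe (H : G.Subgraph) (hH : H.coe.IsTree) :
    IsTreeOn H.spanningCoe H.verts := by
  have hr : ∀ x y : H.verts, H.coe.Reachable x y → H.spanningCoe.Reachable x.1 y.1 := by
    intro x y h
    exact h.map (⟨fun x => x.1, fun h => h⟩ : H.coe →g H.spanningCoe)
  refine ⟨?_, fun x y h => H.edge_vert h, ?_, fun x hx y hy => hr _ _ (hH.connected ⟨x, hx⟩ ⟨y, hy⟩)⟩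
  · obtain ⟨x⟩ := hH.connected.nonempty
    exact ⟨x.1, x.2⟩
  · rw [isAcyclic_iff_forall_adj_isBridge]
    intro v w hvw
    rw [isBridge_iff]
    intro h
    have hb := isBridge_iff.1 (isAcyclic_iff_forall_adj_isBridge.1 hH.isAcyclic
      (v := ⟨v, H.edge_vert hvw⟩) (w := ⟨w, H.edge_vert hvw.symm⟩) hvw)
    apply hb
    have key : ∀ z, (H.spanningCoe.deleteEdges {s(v, w)}).Reachable v z → ∃ hz : z ∈ H.verts,
        (H.coe.deleteEdges {s(⟨v, H.edge_vert hvw⟩, ⟨w, H.edge_vert hvw.symm⟩)}).Reachable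
          ⟨v, H.edge_vert hvw⟩ ⟨z, hz⟩ := by
      intro z hz
      rw [reachable_iff_reflTransGen] at hz
      induction hz with
      | refl => exact ⟨H.edge_vert hvw, Reachable.refl _⟩
      | tail _ hbc ih =>
        obtain ⟨hb, h⟩ := ih
        rw [deleteEdges_adj] at hbc
        refine ⟨H.edge_vert (H.symm.symm _ _ hbc.1), h.trans (Adj.reachable ?_)⟩
        rw [deleteEdges_adj]
        refine ⟨hbc.1, ?_⟩
        simpa [Sym2.eq_iff] using hbc.2
    exact (key w h).2

variable [Finite V]

lemma ncard_le_t {k : ℕ} {H : G.Subgraph} (hH : IsKEndedTree k H) : H.verts.ncard ≤ t G k := by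
  refine le_csSup ⟨Nat.card V, ?_⟩ ⟨H, hH, rfl⟩
  rintro n ⟨H, _, rfl⟩
  exact Set.ncard_le_card _

lemma IsTreeOn.ncard_le_t {k : ℕ} (hT : IsTreeOn T S) (hTG : T ≤ G)
    (hk : (leaves T).ncard ≤ k) : S.ncard ≤ t G k :=
  KEndedTrees.ncard_le_t (H := hT.toSubgraph hTG) (Or.inl ⟨hT.isTree_coe_toSubgraph hTG, by
    rwa [hT.endVertices_toSubgraph]⟩)

end Convert

/-! ### Paths as iterates of `nxt` -/

section Iterate

variable {V : Type*} {G T : SimpleGraph V} {S : Set V}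

lemma iterate_nxt_self (v : V) (n : ℕ) : (fun z => nxt T z v)^[n] v = v := by
  induction n with
  | zero => rfl
  | succ n ih => rw [Function.iterate_succ_apply, nxt_self]; exact ih

lemma IsTreeOn.dist_nxt_le (hT : IsTreeOn T S) {x v : V} (hx : x ∈ S) (hv : v ∈ S) :
    T.dist (nxt T x v) v ≤ T.dist x v := by
  by_cases h : x = v
  · subst h; rw [nxt_self]
  · exact (hT.dist_nxt hx hv h).le

lemma IsTreeOn.dist_iterate_nxt_le (hT : IsTreeOn T S) {x v : V} (hx : x ∈ S) (hv : v ∈ S)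
    (n : ℕ) : T.dist ((fun z => nxt T z v)^[n] x) v ≤ T.dist x v := by
  induction n with
  | zero => exact le_rfl
  | succ n ih =>
    rw [Function.iterate_succ_apply']
    exact (hT.dist_nxt_le (hT.iterate_nxt_mem hx hv n) hv).trans ih

lemma iterate_nxt_ne_of_le {x v : V} {m n : ℕ} (hmn : m ≤ n)
    (h : (fun z => nxt T z v)^[n] x ≠ v) : (fun z => nxt T z v)^[m] x ≠ v := by
  intro h'
  obtain ⟨d, rfl⟩ := Nat.exists_eq_add_of_le' hmn
  rw [Function.iterate_add_apply, h', iterate_nxt_self] at h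
  exact h rfl

lemma IsTreeOn.exists_path_iterate (hT : IsTreeOn T S) {v : V} (hv : v ∈ S) :
    ∀ (n : ℕ) (x : V), x ∈ S → T.dist x v = n → ∃ p : T.Walk x v, p.length ≤ T.dist x v ∧
      ∀ t, (fun z => nxt T z v)^[t] x ∈ p.support := by
  intro n
  induction n using Nat.strong_induction_on with
  | _ n ih =>
    intro x hx hxn
    by_cases hxv : x = v
    · subst hxv
      exact ⟨Walk.nil, by simp, fun t => by simp [iterate_nxt_self]⟩
    · have hlt := hT.dist_nxt hx hv hxv
      obtain ⟨q, hq, hq'⟩ := ih _ (hxn ▸ hlt) _ (hT.nxt_mem hx hv) rfl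
      refine ⟨Walk.cons (hT.adj_nxt hx hv hxv) q, ?_, ?_⟩
      · rw [Walk.length_cons]
        omega
      · rintro (_ | t)
        · simp
        · rw [Walk.support_cons]
          exact List.mem_cons_of_mem _ (hq' t)

/-- From the second vertex on, the path from a leaf `u` to `v` has its predecessor
as the next vertex towards `u`. -/
lemma IsTreeOn.nxt_iterate_back (hT : IsTreeOn T S) {u v : V} (hu : u ∈ S)
    (hv : v ∈ S) (n : ℕ) (h : (fun z => nxt T z v)^[n] u ≠ v) :
    nxt T ((fun z => nxt T z v)^[n + 1] u) u = (fun z => nxt T z v)^[n] u := by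
  induction n with
  | zero =>
    have huv : u ≠ v := h
    have hadj := hT.adj_nxt hu hv huv
    rcases hT.nxt_eq_or hu hadj with h1 | h1
    · rw [nxt_self] at h1
      exact absurd h1 hadj.ne
    · exact h1
  | succ n ih =>
    have h0 := iterate_nxt_ne_of_le (Nat.le_succ n) h
    have ih := ih h0
    have hm := hT.iterate_nxt_mem hu hv (n + 1)
    have hm0 := hT.iterate_nxt_mem hu hv n
    rw [Function.iterate_succ_apply' _ (n + 1)]
    have e1 : (fun z => nxt T z v)^[n + 1] u = nxt T ((fun z => nxt T z v)^[n] u) v :=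
      Function.iterate_succ_apply' _ n u
    generalize (fun z => nxt T z v)^[n + 1] u = y1 at *
    generalize (fun z => nxt T z v)^[n] u = y0 at *
    rcases hT.nxt_eq_or hu (hT.adj_nxt hm hv h) with h1 | h1
    · rw [ih] at h1
      exact absurd h1.symm (hT.not_nxt_eq_and hv (e1 ▸ hT.adj_nxt hm0 hv h0) e1.symm)
    · exact h1

variable [Finite V]

/-- An unbranched path between two leaves is closed under adjacency, hence is the whole tree. -/
lemma IsTreeOn.subset_range_iterate (hT : IsTreeOn T S) {u v : V} (hu : u ∈ leaves T)
    (hv : v ∈ leaves T) (huv : u ≠ v) (h : ∀ n, deg T ((fun z => nxt T z v)^[n] u) ≤ 2) :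
    S ⊆ Set.range fun n => (fun z => nxt T z v)^[n] u := by
  have huS := hT.leaves_subset hu
  have hvS := hT.leaves_subset hv
  refine subset_of_adj_closed hT huS ⟨0, rfl⟩ ?_
  rintro _ ⟨n, rfl⟩ b hb
  induction n with
  | zero =>
    exact ⟨1, eq_of_mem_leaves hu (hT.adj_nxt huS hvS huv) hb⟩
  | succ n ih =>
    by_cases h0 : (fun z => nxt T z v)^[n] u = v
    · refine ih ?_
      dsimp only at hb ⊢
      rw [h0]
      rwa [Function.iterate_succ_apply', h0, nxt_self] at hb
    · have hm0 := hT.iterate_nxt_mem huS hvS n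
      have a1 := hT.adj_nxt hm0 hvS h0
      rw [← Function.iterate_succ_apply' (fun z => nxt T z v)] at a1
      by_cases h1 : (fun z => nxt T z v)^[n + 1] u = v
      · refine ⟨n, ?_⟩
        dsimp only at hb ⊢
        rw [h1] at hb a1
        exact eq_of_mem_leaves hv a1.symm hb
      · have hm1 := hT.iterate_nxt_mem huS hvS (n + 1)
        have a2 := hT.adj_nxt hm1 hvS h1
        rw [← Function.iterate_succ_apply' (fun z => nxt T z v)] at a2
        have hne : (fun z => nxt T z v)^[n] u ≠ (fun z => nxt T z v)^[n + 1 + 1] u := by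
          intro he
          refine hT.not_nxt_eq_and hvS a1 (Function.iterate_succ_apply' (fun z => nxt T z v) _ _).symm ?_
          rw [he]
          exact (Function.iterate_succ_apply' (fun z => nxt T z v) _ _).symm
        rcases eq_or_eq_of_deg_le_two (h (n + 1)) a1.symm a2 hne hb with h2 | h2
        · exact ⟨n, h2.symm⟩
        · exact ⟨n + 2, h2.symm⟩

lemma IsTreeOn.leaves_subset_pair (hT : IsTreeOn T S) {u v : V} (hu : u ∈ leaves T)
    (hv : v ∈ leaves T) (huv : u ≠ v) (h : ∀ n, deg T ((fun z => nxt T z v)^[n] u) ≤ 2) :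
    leaves T ⊆ {u, v} := by
  have huS := hT.leaves_subset hu
  have hvS := hT.leaves_subset hv
  intro w hw
  obtain ⟨n, rfl⟩ := hT.subset_range_iterate hu hv huv h (hT.leaves_subset hw)
  dsimp only at hw ⊢
  cases n with
  | zero => exact Or.inl rfl
  | succ n =>
    by_cases h1 : (fun z => nxt T z v)^[n + 1] u = v
    · exact Or.inr h1
    · exfalso
      have h0 := iterate_nxt_ne_of_le (Nat.le_succ n) h1
      have a1 := hT.adj_nxt (hT.iterate_nxt_mem huS hvS n) hvS h0
      have a2 := hT.adj_nxt (hT.iterate_nxt_mem huS hvS (n + 1)) hvS h1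
      rw [← Function.iterate_succ_apply' (fun z => nxt T z v)] at a1 a2
      refine not_mem_leaves_of a1.symm a2 ?_ hw
      intro he
      refine hT.not_nxt_eq_and hvS a1 (Function.iterate_succ_apply' (fun z => nxt T z v) _ _).symm ?_
      rw [he]
      exact (Function.iterate_succ_apply' (fun z => nxt T z v) _ _).symm

end Iterate

/-! ### Adjacent leaves -/

section Extremal

variable {V : Type*} [Finite V] {G T : SimpleGraph V} {S : Set V} {k : ℕ}

lemma ncard_insert_diff_le {A : Set V} {a u : V} (hu : u ∈ A) :
    (insert a (A \ {u})).ncard ≤ A.ncard := by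
  refine (Set.ncard_insert_le _ _).trans ?_
  rw [Set.ncard_sdiff_singleton_of_mem hu]
  have := (Set.ncard_pos (Set.toFinite A)).2 ⟨u, hu⟩
  omega

/-- A tree with at most `k + 1` leaves, two of which are adjacent, can be replaced
by a `k`-ended tree with the same vertices. -/
lemma IsTreeOn.ncard_le_t_of_adj_leaves (hk : 1 ≤ k) (hT : IsTreeOn T S) (hTG : T ≤ G)
    (hL : (leaves T).ncard ≤ k + 1) {u v : V} (hu : u ∈ leaves T) (hv : v ∈ leaves T)
    (huv : G.Adj u v) : S.ncard ≤ t G k := by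
  have huS := hT.leaves_subset hu
  have hvS := hT.leaves_subset hv
  by_cases hadj : T.Adj u v
  · have hS : S ⊆ {u, v} := by
      refine subset_of_adj_closed hT huS (Or.inl rfl) ?_
      rintro a (rfl | rfl) b hb
      · exact Or.inr (eq_of_mem_leaves hu hb hadj)
      · exact Or.inl (eq_of_mem_leaves hv hb hadj.symm)
    rcases hk.lt_or_eq with hk | rfl
    · refine hT.ncard_le_t hTG ?_
      have := Set.ncard_le_ncard (hT.leaves_subset.trans hS) (Set.toFinite _)
      rw [Set.ncard_pair huv.ne] at this
      omega
    · have h1 := KEndedTrees.ncard_le_t (H := G.subgraphOfAdj huv) (k := 1)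
        (Or.inr ⟨rfl, Or.inr (Or.inl ⟨u, v, huv, rfl⟩)⟩)
      exact (Set.ncard_le_ncard hS (Set.toFinite _)).trans h1
  -- Without a branch vertex between `u` and `v`, the tree is a path: it is 2-ended, and for `k = 1`
  -- the edge `uv` closes it to a cycle.
  by_cases hdeg : ∀ n, deg T ((fun z => nxt T z v)^[n] u) ≤ 2
  · rcases hk.lt_or_eq with hk | rfl
    · refine hT.ncard_le_t hTG ?_
      have := Set.ncard_le_ncard (hT.leaves_subset_pair hu hv huv.ne hdeg) (Set.toFinite _)
      rw [Set.ncard_pair huv.ne] at this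
      omega
    · have hS := hT.subset_range_iterate hu hv huv.ne hdeg
      obtain ⟨p, hp, hps⟩ := hT.exists_path_iterate hvS _ u huS rfl
      have hpath := p.isPath_of_length_eq_dist (le_antisymm hp (dist_le p))
      have hc : (Walk.cons huv.symm (p.mapLe hTG)).IsCycle := by
        rw [Walk.cons_isCycle_iff]
        refine ⟨hpath.mapLe hTG, ?_⟩
        rw [Walk.edges_mapLe_eq_edges]
        intro h
        exact hadj (p.adj_of_mem_edges h).symm
      have h1 := KEndedTrees.ncard_le_t (H := (Walk.cons huv.symm (p.mapLe hTG)).toSubgraph) (k := 1)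
        (Or.inr ⟨rfl, Or.inr (Or.inr ⟨v, _, hc, rfl⟩)⟩)
      refine (Set.ncard_le_ncard (fun x hx => ?_) (Set.toFinite _)).trans h1
      obtain ⟨n, rfl⟩ := hS hx
      rw [Walk.mem_verts_toSubgraph, Walk.support_cons, Walk.support_mapLe_eq_support]
      exact List.mem_cons_of_mem _ (hps n)
  · push Not at hdeg
    obtain ⟨n, hn⟩ := hdeg
    cases n with
    | zero =>
      have : deg T u = 1 := hu
      simp only [Function.iterate_zero, id] at hn
      omega
    | succ n =>
      have h1 : (fun z => nxt T z v)^[n + 1] u ≠ v := by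
        intro h
        rw [h] at hn
        have : deg T v = 1 := hv
        omega
      have h0 := iterate_nxt_ne_of_le (Nat.le_succ n) h1
      have hm0 := hT.iterate_nxt_mem huS hvS n
      have a1 := hT.adj_nxt hm0 hvS h0
      have d1 := hT.dist_nxt hm0 hvS h0
      rw [← Function.iterate_succ_apply' (fun z => nxt T z v)] at a1 d1
      have d2 := hT.dist_lt_of_nxt_eq huS a1.symm (hT.nxt_iterate_back huS hvS n h0)
      -- The edge entering the branch vertex is exchanged for `uv`: two leaves go and at most one
      -- appears.
      refine (hT.isTreeOn_swap a1 huS hvS d2 d1).ncard_le_t (swap_le hTG huv) ?_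
      refine (Set.ncard_le_ncard (leaves_swap_subset hn hu hv huv.ne h0.symm hadj)
        (Set.toFinite _)).trans ((Set.ncard_insert_le _ _).trans ?_)
      have h2 : ({u, v} : Set V) ⊆ leaves T := by
        rintro x (rfl | rfl) <;> assumption
      have := Set.ncard_sdiff_add_ncard_of_subset h2
      rw [Set.ncard_pair huv.ne] at this
      omega

end Extremal

/-! ### Bare paths in a tree larger than all `k`-ended trees -/

section Bare

variable {V : Type*} [Finite V] {G T : SimpleGraph V} {S : Set V} {k : ℕ}

/-- In a tree much larger than every `k`-ended tree, a leaf starts a long bare path, no vertex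
of which is adjacent to another leaf. -/
lemma IsTreeOn.exists_bare_path (hk : 1 ≤ k) : ∀ (s : ℕ) (T : SimpleGraph V) (S : Set V) (u : V),
    IsTreeOn T S → T ≤ G → (leaves T).ncard ≤ k + 1 → u ∈ leaves T → t G k + s < S.ncard →
    ∃ y : ℕ → V, y 0 = u ∧ (∀ i < s, T.Adj (y i) (y (i + 1))) ∧
      (∀ i, i + 2 ≤ s → y i ≠ y (i + 2)) ∧
      ∀ i ≤ s, deg T (y i) ≤ 2 ∧ ∀ w ∈ leaves T, w ≠ u → w ≠ y i ∧ ¬ G.Adj w (y i) := by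
  intro s
  induction s with
  | zero =>
    intro T S u hT hTG hL hu hS
    refine ⟨fun _ => u, rfl, fun i hi => absurd hi (by omega), fun i hi => absurd hi (by omega), fun i _ => ⟨?_, ?_⟩⟩
    · exact (show deg T u = 1 from hu).le.trans (by norm_num)
    · intro w hw hwu
      refine ⟨hwu, fun h => ?_⟩
      have := hT.ncard_le_t_of_adj_leaves hk hTG hL hw hu h
      omega
  | succ s ih =>
    intro T S u hT hTG hL hu hS
    obtain ⟨u', hu'⟩ := exists_adj_of_mem_leaves hu
    have hT' := hT.isTreeOn_isolate hu hu'
    have hTG' : isolate T u ≤ G := isolate_le.trans hTG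
    have hS' : (S \ {u}).ncard + 1 = S.ncard :=
      Set.ncard_sdiff_singleton_add_one (hT.leaves_subset hu) (Set.toFinite _)
    have hsub := leaves_isolate_subset hu hu'
    have hL' : (leaves (isolate T u)).ncard ≤ k + 1 :=
      ((Set.ncard_le_ncard hsub (Set.toFinite _)).trans (ncard_insert_diff_le hu)).trans hL
    -- Otherwise `S \ {u}` would carry a tree with at most `k` leaves and more than `t G k`
    -- vertices.
    have hmem : u' ∈ leaves (isolate T u) := by
      by_contra hc
      have h1 : leaves (isolate T u) ⊆ leaves T \ {u} := fun z hz =>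
        (hsub hz).resolve_left (by rintro rfl; exact hc hz)
      have h2 := hT'.ncard_le_t (k := k) hTG' ((Set.ncard_le_ncard h1 (Set.toFinite _)).trans (by
        rw [Set.ncard_sdiff_singleton_of_mem hu]; omega))
      omega
    have hdeg : deg T u' = 2 := by
      by_contra hc
      exact not_mem_leaves_isolate hc hu' hmem
    obtain ⟨y, hy0, hadj, hne, hy⟩ := ih (isolate T u) (S \ {u}) u' hT' hTG' hL' hmem (by omega)
    refine ⟨fun i => Nat.casesOn i u y, rfl, ?_, ?_, ?_⟩
    · rintro (_ | i) hi
      · simpa [hy0] using hu'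
      · exact (isolate_adj.1 (hadj i (by omega))).1
    · rintro (_ | i) hi
      · exact (isolate_adj.1 (hadj 0 (by omega))).2.2.symm
      · exact hne i (by omega)
    · rintro (_ | i) hi
      · refine ⟨(show deg T u = 1 from hu).le.trans (by norm_num), ?_⟩
        intro w hw hwu
        refine ⟨hwu, fun h => ?_⟩
        have := hT.ncard_le_t_of_adj_leaves hk hTG hL hw hu h
        omega
      · have hyu : y i ≠ u := by
          cases i with
          | zero => rw [hy0]; exact hu'.ne.symm
          | succ i => exact (isolate_adj.1 (hadj i (by omega))).2.2
        have congr : ∀ z, z ≠ u → z ≠ u' → ∀ q, (isolate T u).Adj z q ↔ T.Adj z q := by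
          intro z hzu hzu' q
          rw [isolate_adj]
          refine ⟨fun h => h.1, fun h => ⟨h, hzu, ?_⟩⟩
          rintro rfl
          exact hzu' (eq_of_mem_leaves hu h.symm hu')
        have hyi := hy i (by omega)
        refine ⟨?_, fun w hw hwu => ?_⟩
        · by_cases hyu' : y i = u'
          · exact (hyu' ▸ hdeg).le
          · have : (isolate T u).neighborSet (y i) = T.neighborSet (y i) := by
              ext q; exact congr _ hyu hyu' q
            have h := hyi.1
            unfold deg at h ⊢
            rwa [this] at h
        · have hwu' : w ≠ u' := by
            rintro rfl
            have : deg T w = 1 := hw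
            omega
          exact hyi.2 w ((mem_leaves_congr (congr w hwu hwu')).2 hw) hwu'

/-- The path from `u` to any other leaf has no choice but to follow the bare path of
`exists_bare_path`, as it cannot branch off, turn back or end there. -/
lemma IsTreeOn.bare_iterate (hk : 1 ≤ k) (hT : IsTreeOn T S) (hTG : T ≤ G)
    (hL : (leaves T).ncard ≤ k + 1) {u v : V} (hu : u ∈ leaves T) (hv : v ∈ leaves T)
    (hvu : v ≠ u) {s : ℕ} (hs : t G k + s < S.ncard) :
    deg T ((fun z => nxt T z v)^[s] u) ≤ 2 ∧ ∀ w ∈ leaves T, w ≠ u →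
      w ≠ (fun z => nxt T z v)^[s] u ∧ ¬ G.Adj w ((fun z => nxt T z v)^[s] u) := by
  obtain ⟨y, hy0, hadj, hne, hy⟩ := IsTreeOn.exists_bare_path hk s T S u hT hTG hL hu hs
  have huS := hT.leaves_subset hu
  have hvS := hT.leaves_subset hv
  have key : ∀ i ≤ s, (fun z => nxt T z v)^[i] u = y i := by
    intro i
    induction i using Nat.strong_induction_on with
    | _ i ih =>
    intro hi
    match i with
    | 0 => exact hy0.symm
    | 1 =>
      have := hadj 0 (by omega)
      rw [hy0] at this
      exact eq_of_mem_leaves hu (hT.adj_nxt huS hvS hvu.symm) this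
    | i + 2 =>
      have e0 := ih i (by omega) (by omega)
      have e1 := ih (i + 1) (by omega) (by omega)
      have hm1 : y (i + 1) ∈ S := hT.mem (hadj (i + 1) (by omega))
      rw [Function.iterate_succ_apply', e0] at e1
      rw [Function.iterate_succ_apply', Function.iterate_succ_apply', e0]
      rw [e1]
      have h1 := hadj i (by omega)
      have h2 := hadj (i + 1) (by omega)
      have hyv : y (i + 1) ≠ v := ((hy (i + 1) (by omega)).2 v hv hvu).1.symm
      refine (eq_or_eq_of_deg_le_two (hy (i + 1) (by omega)).1 h1.symm h2 (hne i hi)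
        (hT.adj_nxt hm1 hvS hyv)).resolve_left (hT.not_nxt_eq_and hvS h1 e1)
  rw [key s le_rfl]
  exact hy s le_rfl

/-- If the leaf `v` is adjacent to `x` in `G`, the path from `x` to `v` starts with a long bare
path, no vertex of which is adjacent to another leaf. -/
lemma IsTreeOn.bare_iterate_of_adj (hk : 1 ≤ k) (hT : IsTreeOn T S) (hTG : T ≤ G)
    (hL : (leaves T).ncard ≤ k + 1) {x v : V} (hv : v ∈ leaves T) (hxS : x ∈ S)
    (hx : x ∉ leaves T) (hvx : G.Adj v x) {l r : ℕ} (hl : t G k + l ≤ S.ncard) (hr : r < l) :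
    deg T ((fun z => nxt T z v)^[r + 1] x) ≤ 2 ∧ ∀ w ∈ leaves T, w ≠ v →
      ¬ G.Adj w ((fun z => nxt T z v)^[r + 1] x) := by
  have hvS := hT.leaves_subset hv
  have hxv : x ≠ v := hvx.ne.symm
  have hend : deg T v ≤ 2 ∧ ∀ w ∈ leaves T, w ≠ v → ¬ G.Adj w v := by
    refine ⟨(show deg T v = 1 from hv).le.trans (by norm_num), fun w hw hwv h => ?_⟩
    have := hT.ncard_le_t_of_adj_leaves hk hTG hL hw hv h
    omega
  rw [Function.iterate_succ_apply]
  have hxy := hT.adj_nxt hxS hvS hxv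
  have dxy := hT.dist_nxt hxS hvS hxv
  generalize nxt T x v = y1 at hxy dxy
  -- Iterates of `nxt` stay at `v` once they reach it, so `hend` covers every position past the end
  -- of the path.
  by_cases hyv : y1 = v
  · subst hyv
    rwa [iterate_nxt_self]
  have hy1S := hT.mem_right hxy
  have hyx := hT.nxt_eq_of_dist_lt hvS hxy dxy
  have hnadj : ¬ T.Adj x v := by
    intro h
    apply hyv
    rw [← hyx]
    refine hT.nxt_eq_of_dist_lt hvS h ?_
    rw [dist_self]
    omega
  -- Exchanging `x y1` for `x v` keeps the vertex set and makes `y1` the end of a bare path that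
  -- runs towards `v`.
  have hT' : IsTreeOn (swap T x y1 x v) S := by
    refine hT.isTreeOn_swap hxy hxS hvS ?_ dxy
    rw [dist_self]
    exact (hT.reach hy1S hxS).pos_dist_of_ne hxy.ne.symm
  have hTG' : swap T x y1 x v ≤ G := swap_le hTG hvx.symm
  have hsub := leaves_swap_subset' hx hxy hv hyv hnadj
  have hL' : (leaves (swap T x y1 x v)).ncard ≤ k + 1 :=
    ((Set.ncard_le_ncard hsub (Set.toFinite _)).trans (ncard_insert_diff_le hv)).trans hL
  have hdeg : deg T y1 ≤ 2 := by
    -- If `y1` were a branch vertex, the exchange would remove the leaf `v` and create none.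
    by_contra hc
    have h0 := not_mem_leaves_swap hxy hxv (not_le.1 hc)
    have h1 : leaves (swap T x y1 x v) ⊆ leaves T \ {v} := fun z hz =>
      (hsub hz).resolve_left (by rintro rfl; exact h0 hz)
    have h2 := hT'.ncard_le_t (k := k) hTG' ((Set.ncard_le_ncard h1 (Set.toFinite _)).trans (by
      rw [Set.ncard_sdiff_singleton_of_mem hv]; omega))
    omega
  have hyc := hT.adj_nxt hy1S hvS hyv
  have hcx := hT.not_nxt_eq_and hvS hxy hyx
  have hy1 : y1 ∈ leaves (swap T x y1 x v) :=
    mem_leaves_swap hxy hxv hyv hyc hcx hdeg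
  have hy1' : y1 ∉ leaves T := not_mem_leaves_of hxy.symm hyc hcx.symm
  obtain ⟨y, hy0, hadj, hne, hy⟩ := IsTreeOn.exists_bare_path hk r _ S y1 hT' hTG' hL' hy1
    (by omega)
  -- The two trees differ only in the exchanged edges, so up to `v` the bare path of the new tree
  -- from `y1` is the old path.
  have key : ∀ i ≤ r, (fun z => nxt T z v)^[i] y1 ≠ v → (fun z => nxt T z v)^[i] y1 = y i := by
    intro i
    induction i using Nat.strong_induction_on with
    | _ i ih =>
    intro hi hiv
    cases i with
    | zero => exact hy0.symm
    | succ i =>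
      have hiv0 := iterate_nxt_ne_of_le (Nat.le_succ i) hiv
      have e0 := ih i (by omega) (by omega) hiv0
      have hm0 := hT.iterate_nxt_mem hy1S hvS i
      have d0 := hT.dist_iterate_nxt_le hy1S hvS i
      rw [e0] at hm0 hiv0 d0
      rw [Function.iterate_succ_apply', e0]
      have a1 := hT.adj_nxt hm0 hvS hiv0
      have d1 := hT.dist_nxt hm0 hvS hiv0
      have a1' : (swap T x y1 x v).Adj (y i) (nxt T (y i) v) := by
        refine (swap_adj hxv).2 (Or.inl ⟨a1, fun h => ?_, fun h => ?_⟩)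
        · rw [h.1] at d0; omega
        · rw [h.2] at d1; omega
      cases i with
      | zero =>
        have h1 := hadj 0 (by omega)
        rw [hy0] at a1' h1 ⊢
        exact eq_of_mem_leaves hy1 a1' h1
      | succ i =>
        have h1 := hadj i (by omega)
        have h2 := hadj (i + 1) (by omega)
        have e2 := ih i (by omega) (by omega)
          (iterate_nxt_ne_of_le (by omega : i ≤ i + 1 + 1) hiv)
        rw [Function.iterate_succ_apply', e2] at e0
        have hm2 := hT.iterate_nxt_mem hy1S hvS i
        rw [e2] at hm2
        have hyi : y i ≠ v := by
          rw [← e2]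
          exact iterate_nxt_ne_of_le (by omega : i ≤ i + 1 + 1) hiv
        have a0 := hT.adj_nxt hm2 hvS hyi
        rw [e0] at a0
        exact (eq_or_eq_of_deg_le_two (hy (i + 1) (by omega)).1 h1.symm h2 (hne i (by omega))
          a1').resolve_left (hT.not_nxt_eq_and hvS a0 e0)
  by_cases hrv : (fun z => nxt T z v)^[r] y1 = v
  · rwa [hrv]
  have er := key r le_rfl hrv
  have dr := hT.dist_iterate_nxt_le hy1S hvS r
  rw [er] at dr hrv ⊢
  have hyr := hy r le_rfl
  have hrx : y r ≠ x := fun h => by rw [h] at dr; omega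
  refine ⟨?_, fun w hw hwv => ?_⟩
  · by_cases hry : y r = y1
    · rwa [hry]
    · have : (swap T x y1 x v).neighborSet (y r) = T.neighborSet (y r) := by
        ext q
        rw [mem_neighborSet, mem_neighborSet, swap_adj hxv]
        simp [hrx, hry, hrv]
      have h := hyr.1
      unfold deg at h ⊢
      rwa [this] at h
  · have hwx : w ≠ x := by rintro rfl; exact hx hw
    have hwy : w ≠ y1 := by rintro rfl; exact hy1' hw
    exact (hyr.2 w ((mem_leaves_swap_iff hxv hwx hwy hwv).2 hw) hwy).2

end Bare

/-! ### The structure of a largest tree under the contrary assumption -/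

/-- The `n`-th vertex on the path from `x` to `v` (and `v` itself after its end). -/
noncomputable def toward {V : Type*} (T : SimpleGraph V) (v : V) (n : ℕ) (x : V) : V :=
  (fun z => nxt T z v)^[n] x

/-- The properties of a largest `(k+1)`-ended tree used in the degree count. -/
structure IsRigid {V : Type*} (G T : SimpleGraph V) (S : Set V) (l : ℕ) : Prop where
  tree : IsTreeOn T S
  indep : ∀ u ∈ leaves T, ∀ v ∈ leaves T, ¬ G.Adj u v
  mem : ∀ v ∈ leaves T, ∀ x, G.Adj v x → x ∈ S
  bare : ∀ u ∈ leaves T, ∀ v ∈ leaves T, v ≠ u → ∀ s < l, deg T (toward T v s u) ≤ 2 ∧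
    ∀ w ∈ leaves T, w ≠ u → w ≠ toward T v s u ∧ ¬ G.Adj w (toward T v s u)
  -- The range starts at `1`: `x` itself may branch and may be adjacent to several leaves.
  bare_adj : ∀ v ∈ leaves T, ∀ x, G.Adj v x → ∀ r, 1 ≤ r → r ≤ l → deg T (toward T v r x) ≤ 2 ∧
    ∀ w ∈ leaves T, w ≠ v → ¬ G.Adj w (toward T v r x)

section Toward

variable {V : Type*} {G T : SimpleGraph V} {S : Set V} {l : ℕ}

@[simp] lemma toward_zero (v x : V) : toward T v 0 x = x := rfl

lemma toward_succ (v : V) (n : ℕ) (x : V) : toward T v (n + 1) x = nxt T (toward T v n x) v :=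
  Function.iterate_succ_apply' _ _ _

lemma IsTreeOn.toward_mem (hT : IsTreeOn T S) {v x : V} (hv : v ∈ S) (hx : x ∈ S) (n : ℕ) :
    toward T v n x ∈ S := hT.iterate_nxt_mem hx hv n

lemma toward_ne_of_le {v x : V} {m n : ℕ} (hmn : m ≤ n) (h : toward T v n x ≠ v) :
    toward T v m x ≠ v := iterate_nxt_ne_of_le hmn h

lemma IsTreeOn.adj_toward (hT : IsTreeOn T S) {v x : V} (hv : v ∈ S) (hx : x ∈ S) {n : ℕ}
    (h : toward T v n x ≠ v) : T.Adj (toward T v n x) (toward T v (n + 1) x) := by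
  rw [toward_succ]
  exact hT.adj_nxt (hT.toward_mem hv hx n) hv h

lemma IsTreeOn.toward_ne_add_two (hT : IsTreeOn T S) {v x : V} (hv : v ∈ S) (hx : x ∈ S) {n : ℕ}
    (h : toward T v n x ≠ v) : toward T v n x ≠ toward T v (n + 2) x := by
  intro he
  refine hT.not_nxt_eq_and hv (hT.adj_toward hv hx h) (toward_succ v n x).symm ?_
  rw [← toward_succ, ← he]

/-- The path from `x` to the leaf `v` has no inner vertices that are leaves. -/
lemma IsTreeOn.toward_eq_of_mem_leaves (hT : IsTreeOn T S) {v x : V} (hv : v ∈ S) (hx : x ∈ S)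
    {n : ℕ} (h : toward T v (n + 1) x ∈ leaves T) : toward T v (n + 1) x = v := by
  by_contra hne
  have hne0 := toward_ne_of_le (Nat.le_succ n) hne
  exact hT.toward_ne_add_two hv hx hne0
    (eq_of_mem_leaves h (hT.adj_toward hv hx hne0).symm (hT.adj_toward hv hx hne))

variable [Finite V]

/-- The leaves beyond a bare path are the same at all its vertices. -/
lemma IsTreeOn.nxt_eq_toward_iff (hT : IsTreeOn T S) {v x h : V} (hv : v ∈ leaves T) (hx : x ∈ S)
    (hh : h ∈ leaves T) (n : ℕ)
    (hn : ∀ i ≤ n, toward T v i x ∉ leaves T) (hd : ∀ i, 1 ≤ i → i ≤ n → deg T (toward T v i x) ≤ 2) :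
    nxt T x h = nxt T x v ↔ nxt T (toward T v n x) h = toward T v (n + 1) x := by
  induction n with
  | zero => rw [toward_succ]; rfl
  | succ n ih =>
    rw [ih (fun i hi => hn i (by omega)) (fun i h1 hi => hd i h1 (by omega))]
    have hvS := hT.leaves_subset hv
    have hhS := hT.leaves_subset hh
    have n1 : toward T v (n + 1) x ≠ v := (ne_of_mem_of_not_mem hv (hn (n + 1) le_rfl)).symm
    have n0 := toward_ne_of_le (Nat.le_succ n) n1
    have a0 := hT.adj_toward hvS hx n0
    have a1 := hT.adj_toward hvS hx n1
    have hne := hT.toward_ne_add_two hvS hx n0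
    have n2 : toward T v (n + 1) x ≠ h := (ne_of_mem_of_not_mem hh (hn (n + 1) le_rfl)).symm
    have a2 := hT.adj_nxt (hT.toward_mem hvS hx (n + 1)) hhS n2
    constructor
    · intro h1
      exact (eq_or_eq_of_deg_le_two (hd (n + 1) (by omega) le_rfl) a0.symm a1 hne a2).resolve_left
        (hT.not_nxt_eq_and hhS a0 h1)
    · intro h1
      refine (hT.nxt_eq_or hhS a0).resolve_right fun h2 => hne ?_
      rw [← h2, h1]

end Toward

/-! ### The shift by rank and its injectivity -/

section Shift

variable {V : Type*} {G T : SimpleGraph V} {S : Set V} {l : ℕ}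

open Classical in
/-- The elements of `J` that lie in the same direction from `x` as `i`. -/
noncomputable def sameDir (T : SimpleGraph V) (J : Finset V) (x i : V) : Finset V :=
  J.filter fun h => nxt T x h = nxt T x i

open Classical in
/-- The rank of `i` among the elements of `J` that lie in the same direction from `x`. -/
noncomputable def rank (T : SimpleGraph V) (e : V → ℕ) (J : Finset V) (x i : V) : ℕ :=
  ((sameDir T J x i).filter fun h => e h ≤ e i).card

lemma rank_le_card (e : V → ℕ) (J : Finset V) (x i : V) :
    rank T e J x i ≤ (sameDir T J x i).card := by
  classical
  exact Finset.card_filter_le _ _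

lemma sameDir_subset (J : Finset V) (x i : V) : sameDir T J x i ⊆ J := by
  classical
  exact Finset.filter_subset _ _

lemma mem_sameDir {J : Finset V} {x i h : V} :
    h ∈ sameDir T J x i ↔ h ∈ J ∧ nxt T x h = nxt T x i := by
  classical
  exact Finset.mem_filter

lemma one_le_rank (e : V → ℕ) {J : Finset V} {x i : V} (hi : i ∈ J) : 1 ≤ rank T e J x i := by
  classical
  exact Finset.card_pos.2 ⟨i, Finset.mem_filter.2 ⟨mem_sameDir.2 ⟨hi, rfl⟩, le_rfl⟩⟩

lemma rank_lt_of_lt {e : V → ℕ} {J : Finset V} {x y i j : V} (hj : j ∈ J)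
    (hD : sameDir T J x i = sameDir T J y j) (hlt : e i < e j) :
    rank T e J x i < rank T e J y j := by
  classical
  unfold rank
  rw [hD]
  refine Finset.card_lt_card ?_
  rw [Finset.ssubset_iff_of_subset]
  · exact ⟨j, Finset.mem_filter.2 ⟨mem_sameDir.2 ⟨hj, rfl⟩, le_rfl⟩,
      fun h => absurd (Finset.mem_filter.1 h).2 (by omega)⟩
  · intro h hh
    rw [Finset.mem_filter] at hh ⊢
    exact ⟨hh.1, by omega⟩

lemma rank_eq_iff {e : V → ℕ} (he : Function.Injective e) {J : Finset V} {x y i j : V}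
    (hi : i ∈ J) (hj : j ∈ J) (hD : sameDir T J x i = sameDir T J y j) :
    rank T e J x i = rank T e J y j ↔ i = j := by
  constructor
  · intro h
    apply he
    rcases lt_trichotomy (e i) (e j) with h1 | h1 | h1
    · have := rank_lt_of_lt hj hD h1; omega
    · exact h1
    · have := rank_lt_of_lt hi hD.symm h1; omega
  · rintro rfl
    unfold rank
    rw [hD]

variable {J : Finset V} {e : V → ℕ}

lemma IsRigid.not_mem_leaves (h : IsRigid G T S l) {v x : V} (hv : v ∈ leaves T)
    (hx : G.Adj v x) : x ∉ leaves T := fun hc => h.indep v hv x hc hx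

variable [Finite V]

/-- Moving by the rank does not reach the end of the path. -/
lemma IsRigid.toward_not_mem_leaves (h : IsRigid G T S l) (hJ : ∀ v ∈ J, v ∈ leaves T)
    (hJl : J.card ≤ l) {v x : V} (hv : v ∈ J) (hx : G.Adj v x) :
    ∀ n < rank T e J x v, toward T v n x ∉ leaves T := by
  intro n
  have hvL := hJ v hv
  have hvS := h.tree.leaves_subset hvL
  have hxS := h.mem v hvL x hx
  induction n using Nat.strong_induction_on with
  | _ n ih =>
  intro hn hc
  cases n with
  | zero => exact h.not_mem_leaves hvL hx hc
  | succ n =>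
    have hend := h.tree.toward_eq_of_mem_leaves hvS hxS hc
    have hrk := rank_le_card (T := T) e J x v
    have hsub := Finset.card_le_card (sameDir_subset (T := T) J x v)
    -- Another leaf in the direction of `v` would lie beyond `v`, which is an end. So `v` is alone
    -- in its direction and its rank is `1`, too small for position `n + 1`.
    have hD : sameDir T J x v ⊆ {v} := by
      intro w hw
      rw [mem_sameDir] at hw
      rw [Finset.mem_singleton]
      by_contra hwv
      have hwL := hJ w hw.1
      have h1 := (h.tree.nxt_eq_toward_iff hvL hxS hwL n (fun i hi => ih i (by omega) (by omega))
        (fun i h1 hi => (h.bare_adj v hvL x hx i h1 (by omega)).1)).1 hw.2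
      have n0 : toward T v n x ≠ v := (ne_of_mem_of_not_mem hvL (ih n (by omega) (by omega))).symm
      have a0 := h.tree.adj_toward hvS hxS n0
      rw [hend] at h1 a0
      exact h.tree.not_nxt_eq_and (h.tree.leaves_subset hwL) a0 h1
        (eq_of_mem_leaves hvL (h.tree.adj_nxt hvS (h.tree.leaves_subset hwL) (Ne.symm hwv)) a0.symm)
    have := Finset.card_le_card hD
    rw [Finset.card_singleton] at this
    omega

/-- As nothing branches off between `x` and the target of the shift, the direction set can be read
off at the last edge before the target. This allows comparing the sets of two shifts that meet. -/
lemma IsRigid.sameDir_eq (h : IsRigid G T S l) (hJ : ∀ v ∈ J, v ∈ leaves T)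
    (hJl : J.card ≤ l) {v x : V} (hv : v ∈ J) (hx : G.Adj v x) {s : ℕ}
    (hs : rank T e J x v = s + 1) (w : V) :
    w ∈ sameDir T J x v ↔ w ∈ J ∧ nxt T (toward T v s x) w = toward T v (s + 1) x := by
  rw [mem_sameDir]
  refine and_congr_right fun hw => ?_
  have hvL := hJ v hv
  have hrk := rank_le_card (T := T) e J x v
  have hsub := Finset.card_le_card (sameDir_subset (T := T) J x v)
  exact h.tree.nxt_eq_toward_iff hvL (h.mem v hvL x hx) (hJ w hw) s
    (fun i hi => h.toward_not_mem_leaves (e := e) hJ hJl hv hx i (by omega))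
    (fun i h1 hi => (h.bare_adj v hvL x hx i h1 (by omega)).1)

/-- Two paths that run together at one vertex, in the same direction, also do so before. -/
lemma IsTreeOn.toward_sub_eq (hT : IsTreeOn T S) {v x w y : V} (hv : v ∈ leaves T) (hx : x ∈ S)
    (hw : w ∈ leaves T) (hy : y ∈ S) {s r : ℕ}
    (hs : ∀ i ≤ s, toward T v i x ∉ leaves T) (hd : ∀ i, 1 ≤ i → i ≤ s → deg T (toward T v i x) ≤ 2)
    (hr : ∀ i ≤ r, toward T w i y ∉ leaves T)
    (h0 : toward T v s x = toward T w r y) (h1 : toward T v (s + 1) x = toward T w (r + 1) y) :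
    ∀ d, d ≤ s → d ≤ r → toward T v (s - d) x = toward T w (r - d) y ∧
      toward T v (s - d + 1) x = toward T w (r - d + 1) y := by
  intro d
  have hvS := hT.leaves_subset hv
  have hwS := hT.leaves_subset hw
  induction d with
  | zero => exact fun _ _ => ⟨h0, h1⟩
  | succ d ih =>
    intro hds hdr
    obtain ⟨e0, e1⟩ := ih (by omega) (by omega)
    obtain ⟨a, ha⟩ : ∃ a, s - d = a + 1 := ⟨s - d - 1, by omega⟩
    obtain ⟨b, hb⟩ : ∃ b, r - d = b + 1 := ⟨r - d - 1, by omega⟩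
    rw [show s - (d + 1) = a by omega, show r - (d + 1) = b by omega]
    rw [ha, hb] at e0 e1
    refine ⟨?_, e0⟩
    have n0 : toward T v a x ≠ v := (ne_of_mem_of_not_mem hv (hs a (by omega))).symm
    have n1 : toward T v (a + 1) x ≠ v := (ne_of_mem_of_not_mem hv (hs (a + 1) (by omega))).symm
    have m0 : toward T w b y ≠ w := (ne_of_mem_of_not_mem hw (hr b (by omega))).symm
    have a0 := hT.adj_toward hvS hx n0
    have a1 := hT.adj_toward hvS hx n1
    have b0 := hT.adj_toward hwS hy m0
    have hne := hT.toward_ne_add_two hvS hx n0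
    have hne' := hT.toward_ne_add_two hwS hy m0
    rw [← e0] at b0
    rcases eq_or_eq_of_deg_le_two (hd (a + 1) (by omega) (by omega)) a0.symm a1 hne b0.symm
      with h | h
    · exact h.symm
    · exact absurd (h.trans e1) hne'

/-- Two shifts with the same target arrive either through the same edge or from opposite sides. In
the first case their direction sets agree, and either the ranks coincide or the longer shift passes
the start of the shorter one. In the second case the direction sets are disjoint, so both shifts
together have length at most `l`, and the path from `x` to `v` reaches `y` within its bare range.
Passing `y` is impossible, since `y` is adjacent to the leaf `w ≠ v`. -/
lemma IsRigid.shift_injective_aux (h : IsRigid G T S l) (he : Function.Injective e)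
    (hJ : ∀ v ∈ J, v ∈ leaves T) (hJl : J.card ≤ l) {v x w y : V} (hv : v ∈ J) (hx : G.Adj v x)
    (hw : w ∈ J) (hy : G.Adj w y)
    (heq : toward T v (rank T e J x v) x = toward T w (rank T e J y w) y)
    (hle : rank T e J y w ≤ rank T e J x v) : v = w ∧ x = y := by
  have hvL := hJ v hv
  have hwL := hJ w hw
  have hvS := h.tree.leaves_subset hvL
  have hwS := h.tree.leaves_subset hwL
  have hxS := h.mem v hvL x hx
  have hyS := h.mem w hwL y hy
  obtain ⟨s, hs⟩ : ∃ s, rank T e J x v = s + 1 :=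
    ⟨rank T e J x v - 1, by have := one_le_rank (T := T) e (x := x) hv; omega⟩
  obtain ⟨r, hr⟩ : ∃ r, rank T e J y w = r + 1 :=
    ⟨rank T e J y w - 1, by have := one_le_rank (T := T) e (x := y) hw; omega⟩
  have hDx := h.sameDir_eq hJ hJl hv hx hs
  have hDy := h.sameDir_eq hJ hJl hw hy hr
  have hsl : s + 1 ≤ (sameDir T J x v).card := hs ▸ rank_le_card (T := T) e J x v
  have hrl : r + 1 ≤ (sameDir T J y w).card := hr ▸ rank_le_card (T := T) e J y w
  have hsl' := Finset.card_le_card (sameDir_subset (T := T) J x v)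
  have hrl' := Finset.card_le_card (sameDir_subset (T := T) J y w)
  have hX := h.toward_not_mem_leaves (e := e) hJ hJl hv hx
  have hY := h.toward_not_mem_leaves (e := e) hJ hJl hw hy
  have hXd := fun i h1 h2 => (h.bare_adj v hvL x hx i h1 h2).1
  have hYd := fun i h1 h2 => (h.bare_adj w hwL y hy i h1 h2).1
  by_cases hpq : toward T v s x = toward T w r y
  · have hD : sameDir T J x v = sameDir T J y w := by
      ext z
      rw [hDx, hDy, hpq, ← hs, ← hr, heq]
    have hiff := rank_eq_iff he hv hw hD
    have hback := h.tree.toward_sub_eq hvL hxS hwL hyS (fun i hi => hX i (by omega))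
      (fun i h1 h2 => hXd i h1 (by omega)) (fun i hi => hY i (by omega)) hpq
      (by rw [← hs, ← hr, heq]) r (by omega) le_rfl
    have hback := hback.1
    rw [Nat.sub_self, toward_zero] at hback
    rcases hle.lt_or_eq with hlt | h1
    · exfalso
      -- Here `y` lies `s - r ≥ 1` steps after `x` on the way to `v`, and unequal ranks force `w ≠
      -- v`.
      refine (h.bare_adj v hvL x hx (s - r) (by omega) (by omega)).2 w hwL ?_ ?_
      · rintro rfl
        have := hiff.2 rfl
        omega
      · rwa [hback]
    · refine ⟨hiff.1 h1.symm, ?_⟩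
      rw [show s - r = 0 by omega] at hback
      exact hback
  · exfalso
    rw [hs, hr] at heq
    rw [hs] at hX
    rw [hr] at hY
    have ns : ∀ i ≤ s, toward T v i x ≠ v := fun i hi => (ne_of_mem_of_not_mem hvL (hX i (by omega))).symm
    have nr : ∀ i ≤ r, toward T w i y ≠ w := fun i hi => (ne_of_mem_of_not_mem hwL (hY i (by omega))).symm
    have as := h.tree.adj_toward hvS hxS (ns s le_rfl)
    have ar := h.tree.adj_toward hwS hyS (nr r le_rfl)
    have hz : toward T v (s + 1) x ∉ leaves T := fun hz =>
      hpq (eq_of_mem_leaves hz as.symm (heq ▸ ar.symm))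
    have hzd := hXd (s + 1) (by omega) (by omega)
    have hzS := h.tree.toward_mem hvS hxS (s + 1)
    have hnb : ∀ q, T.Adj (toward T v (s + 1) x) q → q = toward T v s x ∨ q = toward T w r y :=
      fun q hq => eq_or_eq_of_deg_le_two hzd as.symm (heq ▸ ar.symm) hpq hq
    -- From the common target, a leaf in both sets could be approached through neither of its two
    -- neighbours without turning back.
    have hdisj : Disjoint (sameDir T J x v) (sameDir T J y w) := by
      rw [Finset.disjoint_left]
      intro u hu1 hu2
      have hu1' := ((hDx u).1 hu1).2
      have hu2' := ((hDy u).1 hu2).2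
      have huL := hJ u ((hDx u).1 hu1).1
      have huS := h.tree.leaves_subset huL
      rw [← heq] at hu2' ar
      rcases hnb _ (h.tree.adj_nxt hzS huS ((ne_of_mem_of_not_mem huL hz).symm)) with h1 | h1
      · exact h.tree.not_nxt_eq_and huS as hu1' h1
      · exact h.tree.not_nxt_eq_and huS ar hu2' h1
    -- Each shift length is at most the size of its direction set, and the disjoint sets fit into
    -- `J`.
    have hsum : s + 1 + (r + 1) ≤ l := by
      classical
      have := Finset.card_union_of_disjoint hdisj
      have h2 := Finset.card_le_card
        (Finset.union_subset (sameDir_subset (T := T) J x v) (sameDir_subset (T := T) J y w))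
      omega
    have hzv : toward T v (s + 1) x ≠ v := (ne_of_mem_of_not_mem hvL hz).symm
    have hzw : toward T v (s + 1) x ≠ w := (ne_of_mem_of_not_mem hwL hz).symm
    have hnv : toward T v (s + 2) x = toward T w r y := by
      rcases hnb _ (h.tree.adj_toward hvS hxS hzv) with h1 | h1
      · exact absurd h1.symm (h.tree.toward_ne_add_two hvS hxS (ns s le_rfl))
      · exact h1
    have hwv : w ≠ v := by
      rintro rfl
      refine h.tree.toward_ne_add_two hwS hyS (nr r le_rfl) ?_
      rw [← hnv, toward_succ, heq, toward_succ w (r + 1) y]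
    -- Beyond the common target, the path to `v` runs through the other shift backwards and arrives
    -- at `y` after `s + 2 + r` steps.
    have hforward : ∀ d ≤ r, toward T v (s + 2 + d) x = toward T w (r - d) y ∧
        toward T v (s + 1 + d) x = toward T w (r - d + 1) y := by
      intro d
      induction d with
      | zero => exact fun _ => ⟨hnv, heq⟩
      | succ d ih =>
        intro hd
        obtain ⟨e0, e1⟩ := ih (by omega)
        obtain ⟨b, hb⟩ : ∃ b, r - d = b + 1 := ⟨r - d - 1, by omega⟩
        rw [show r - (d + 1) = b by omega, show s + 2 + (d + 1) = s + 1 + d + 2 by omega,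
          show s + 1 + (d + 1) = s + 1 + d + 1 by omega]
        rw [hb] at e0 e1
        rw [show s + 2 + d = s + 1 + d + 1 by omega] at e0
        refine ⟨?_, e0⟩
        have n1 : toward T v (s + 1 + d + 1) x ≠ v := by
          rw [e0]
          exact fun he => hY (b + 1) (by omega) (he ▸ hvL)
        have n0 := toward_ne_of_le (Nat.le_succ _) n1
        have a1 := h.tree.adj_toward hvS hxS n1
        have hne := h.tree.toward_ne_add_two hvS hxS n0
        have b0 := h.tree.adj_toward hwS hyS (nr b (by omega))
        have b1 := h.tree.adj_toward hwS hyS (nr (b + 1) (by omega))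
        have hne' := h.tree.toward_ne_add_two hwS hyS (nr b (by omega))
        rw [e0] at a1
        rcases eq_or_eq_of_deg_le_two (hYd (b + 1) (by omega) (by omega)) b0.symm b1 hne' a1
          with h1 | h1
        · exact h1
        · exact absurd (e1.trans h1.symm) hne
    have hend := (hforward r le_rfl).1
    rw [Nat.sub_self, toward_zero] at hend
    refine (h.bare_adj v hvL x hx (s + 2 + r) (by omega) (by omega)).2 w hwL hwv ?_
    rwa [hend]

lemma IsRigid.shift_injective (h : IsRigid G T S l) (he : Function.Injective e)
    (hJ : ∀ v ∈ J, v ∈ leaves T) (hJl : J.card ≤ l) {v x w y : V} (hv : v ∈ J) (hx : G.Adj v x)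
    (hw : w ∈ J) (hy : G.Adj w y)
    (heq : toward T v (rank T e J x v) x = toward T w (rank T e J y w) y) : v = w ∧ x = y := by
  rcases le_total (rank T e J y w) (rank T e J x v) with hle | hle
  · exact h.shift_injective_aux he hJ hJl hv hx hw hy heq hle
  · have := h.shift_injective_aux he hJ hJl hw hy hv hx heq.symm hle
    exact ⟨this.1.symm, this.2.symm⟩

end Shift

/-! ### Tails at the leaves outside the chosen set -/

section Tail

variable {V : Type*} {G T : SimpleGraph V} {S : Set V} {l : ℕ}

lemma IsRigid.tail_injective (h : IsRigid G T S l) {u v : V} (hu : u ∈ leaves T)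
    (hv : v ∈ leaves T) (hvu : v ≠ u) {t s : ℕ} (hts : t < s) (hs : s < l) :
    toward T v t u ≠ toward T v s u := by
  have huS := h.tree.leaves_subset hu
  have hvS := h.tree.leaves_subset hv
  suffices T.dist (toward T v s u) v < T.dist (toward T v t u) v by
    intro he
    rw [he] at this
    omega
  have hstep : ∀ i < l, T.dist (toward T v (i + 1) u) v < T.dist (toward T v i u) v := by
    intro i hi
    rw [toward_succ]
    exact h.tree.dist_nxt (h.tree.toward_mem hvS huS i) hvS
      ((h.bare u hu v hv hvu i hi).2 v hv hvu).1.symm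
  induction s with
  | zero => omega
  | succ s ih =>
    have h1 := hstep s (by omega)
    rcases (Nat.lt_succ_iff.1 hts).lt_or_eq with h2 | rfl
    · exact h1.trans (ih h2 (by omega))
    · exact h1

variable [Finite V]

/-- The first vertices on the path from a leaf `u` to a leaf `v` do not depend on `v`. -/
lemma IsRigid.nxt_tail (h : IsRigid G T S l) {u v w : V} (hu : u ∈ leaves T) (hv : v ∈ leaves T)
    (hvu : v ≠ u) (hw : w ∈ leaves T) (hwu : w ≠ u) :
    ∀ n < l, nxt T (toward T v n u) w = toward T v (n + 1) u := by
  intro n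
  have huS := h.tree.leaves_subset hu
  have hvS := h.tree.leaves_subset hv
  have hwS := h.tree.leaves_subset hw
  induction n with
  | zero =>
    intro _
    rw [toward_succ, toward_zero]
    exact eq_of_mem_leaves hu (h.tree.adj_nxt huS hwS hwu.symm) (h.tree.adj_nxt huS hvS hvu.symm)
  | succ n ih =>
    intro hn
    have ih := ih (by omega)
    have hb := h.bare u hu v hv hvu (n + 1) hn
    have n1 := (hb.2 v hv hvu).1.symm
    have n0 := toward_ne_of_le (Nat.le_succ n) n1
    have a0 := h.tree.adj_toward hvS huS n0
    exact (eq_or_eq_of_deg_le_two hb.1 a0.symm (h.tree.adj_toward hvS huS n1)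
      (h.tree.toward_ne_add_two hvS huS n0)
      (h.tree.adj_nxt (h.tree.toward_mem hvS huS _) hwS (hb.2 w hw hwu).1.symm)).resolve_left
      (h.tree.not_nxt_eq_and hwS a0 ih)

/-- A path from a neighbour `x` of a leaf `v ≠ u` to `v` avoids the tail at `u`. -/
lemma IsRigid.toward_ne_tail (h : IsRigid G T S l) {u v w x : V} (hu : u ∈ leaves T)
    (hv : v ∈ leaves T) (hvu : v ≠ u) (hw : w ∈ leaves T) (hwu : w ≠ u) (hx : G.Adj w x) :
    ∀ t < l, ∀ s, toward T w s x ≠ toward T v t u := by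
  have huS := h.tree.leaves_subset hu
  have hvS := h.tree.leaves_subset hv
  have hwS := h.tree.leaves_subset hw
  have hxS := h.mem w hw x hx
  intro t
  induction t with
  | zero =>
    intro _ s hs
    rw [toward_zero] at hs
    cases s with
    | zero =>
      rw [toward_zero] at hs
      exact h.indep w hw u hu (hs ▸ hx)
    | succ s =>
      have := h.tree.toward_eq_of_mem_leaves hwS hxS (hs ▸ hu)
      exact hwu (this.symm.trans hs)
  | succ t ih =>
    intro ht s hs
    have hb := h.bare u hu v hv hvu (t + 1) ht
    cases s with
    | zero =>
      rw [toward_zero] at hs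
      exact (hb.2 w hw hwu).2 (hs ▸ hx)
    | succ s =>
      refine ih (by omega) s ?_
      have m1 : toward T w (s + 1) x ≠ w := hs ▸ (hb.2 w hw hwu).1.symm
      have m0 := toward_ne_of_le (Nat.le_succ s) m1
      have b0 := h.tree.adj_toward hwS hxS m0
      have n1 := (hb.2 v hv hvu).1.symm
      have n0 := toward_ne_of_le (Nat.le_succ t) n1
      have a0 := h.tree.adj_toward hvS huS n0
      have hs' := hs
      rw [toward_succ] at hs'
      rw [hs] at b0
      -- The path to `w` leaves the tail vertex away from `u`, so it cannot have come from that
      -- side; it came from the preceding tail vertex, and induction applies.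
      refine (eq_or_eq_of_deg_le_two hb.1 a0.symm (h.tree.adj_toward hvS huS n1)
        (h.tree.toward_ne_add_two hvS huS n0) b0.symm).resolve_right fun hc => ?_
      refine h.tree.not_nxt_eq_and hwS b0 hs' ?_
      rw [hc]
      exact h.nxt_tail hu hv hvu hw hwu (t + 1) ht

/-- Tails that meet continue alike towards `v`, so they also agree one step earlier. Going back ends
with one of the two leaves on the tail of the other. -/
lemma IsRigid.tail_disjoint (h : IsRigid G T S l) {u u' v : V} (hu : u ∈ leaves T)
    (hu' : u' ∈ leaves T) (hv : v ∈ leaves T) (hvu : v ≠ u) (hvu' : v ≠ u') (huu' : u ≠ u') :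
    ∀ t < l, ∀ s < l, toward T v t u ≠ toward T v s u' := by
  have huS := h.tree.leaves_subset hu
  have huS' := h.tree.leaves_subset hu'
  have hvS := h.tree.leaves_subset hv
  intro t
  induction t with
  | zero =>
    intro _ s hs he
    exact ((h.bare u' hu' v hv hvu' s hs).2 u hu huu').1 he
  | succ t ih =>
    intro ht s hs he
    cases s with
    | zero => exact ((h.bare u hu v hv hvu (t + 1) ht).2 u' hu' huu'.symm).1 he.symm
    | succ s =>
      refine ih (by omega) s (by omega) ?_
      have hb := h.bare u hu v hv hvu (t + 1) ht
      have n1 := (hb.2 v hv hvu).1.symm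
      have n0 := toward_ne_of_le (Nat.le_succ t) n1
      have m0 := toward_ne_of_le (Nat.le_succ s) ((h.bare u' hu' v hv hvu' (s + 1) hs).2 v hv hvu').1.symm
      have a0 := h.tree.adj_toward hvS huS n0
      have b0 := h.tree.adj_toward hvS huS' m0
      have hne := h.tree.toward_ne_add_two hvS huS' m0
      rw [← he] at b0
      refine ((eq_or_eq_of_deg_le_two hb.1 a0.symm (h.tree.adj_toward hvS huS n1)
        (h.tree.toward_ne_add_two hvS huS n0) b0.symm).resolve_right fun hc => hne ?_).symm
      rw [hc, toward_succ v (t + 1), toward_succ v (s + 1), he]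

end Tail

/-! ### The degree count -/

section Count

variable {V : Type*} [Finite V] {G T : SimpleGraph V} {S : Set V} {l : ℕ}

/-- The left side counts disjoint sets of vertices of the tree: the images of the pairs (leaf in
`I`, neighbour), the vertex `v₀`, and a tail of `l` vertices at each leaf outside `I`. Leaving the
neighbours of `v₀` unshifted keeps all ranks at most `I.card - 1 ≤ l`. -/
lemma IsRigid.sum_deg_add_le (h : IsRigid G T S l) {I : Finset V} (hI : ∀ v ∈ I, v ∈ leaves T)
    (hne : I.Nonempty) (hIl : I.card ≤ l + 1) :
    ∑ v ∈ I, deg G v + 1 + l * ((leaves T).ncard - I.card) ≤ S.ncard := by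
  classical
  have := Fintype.ofFinite V
  obtain ⟨v₀, hv₀⟩ := hne
  obtain ⟨e, he⟩ : ∃ e : V → ℕ, Function.Injective e :=
    ⟨fun v => (Fintype.equivFin V v : ℕ), Fin.val_injective.comp (Fintype.equivFin V).injective⟩
  have h₀L := hI v₀ hv₀
  have h₀S := h.tree.leaves_subset h₀L
  have hJ : ∀ v ∈ I.erase v₀, v ∈ leaves T := fun v hv => hI v (Finset.mem_of_mem_erase hv)
  have hJc : (I.erase v₀).card ≤ l := by
    rw [Finset.card_erase_of_mem hv₀]
    omega
  set J := I.erase v₀ with hJdef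
  let shift : V → V → ℕ := fun v x => if v = v₀ then 0 else rank T e J x v
  have hmemJ : ∀ v ∈ I, v ≠ v₀ → v ∈ J := fun v hv hv' => Finset.mem_erase.2 ⟨hv', hv⟩
  let P : Finset (Σ _ : V, V) := I.sigma fun v => (G.neighborSet v).toFinset
  let Φ : (Σ _ : V, V) → V := fun p => toward T p.1 (shift p.1 p.2) p.2
  have hPcard : P.card = ∑ v ∈ I, deg G v := by
    rw [Finset.card_sigma]
    refine Finset.sum_congr rfl fun v _ => ?_
    rw [deg, Set.ncard_eq_toFinset_card']
  have hPmem : ∀ p ∈ P, p.1 ∈ I ∧ G.Adj p.1 p.2 := by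
    intro p hp
    simpa [P] using hp
  have hrank : ∀ v ∈ J, ∀ x, 1 ≤ rank T e J x v ∧ rank T e J x v ≤ l := by
    intro v hv x
    refine ⟨one_le_rank e hv, (rank_le_card e J x v).trans ?_⟩
    exact (Finset.card_le_card (sameDir_subset J x v)).trans hJc
  have hΦinj : Set.InjOn Φ P := by
    rintro ⟨v, x⟩ hp ⟨w, y⟩ hq heq
    obtain ⟨hv, hx⟩ := hPmem _ hp
    obtain ⟨hw, hy⟩ := hPmem _ hq
    simp only [Φ, shift] at heq hv hx hw hy
    by_cases hv0 : v = v₀ <;> by_cases hw0 : w = v₀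
    · subst hv0; subst hw0
      simp only [if_true, toward_zero] at heq
      rw [heq]
    -- An unshifted image is adjacent to `v₀`, whereas a shifted one is adjacent to no leaf except
    -- possibly its own.
    · exfalso
      subst hv0
      simp only [if_true, if_neg hw0, toward_zero] at heq
      have hwJ := hmemJ w hw hw0
      have hr := hrank w hwJ y
      refine (h.bare_adj w (hI w hw) y hy _ hr.1 hr.2).2 v (hI v hv) (Ne.symm hw0) ?_
      rwa [← heq]
    · exfalso
      subst hw0
      simp only [if_true, if_neg hv0, toward_zero] at heq
      have hvJ := hmemJ v hv hv0
      have hr := hrank v hvJ x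
      refine (h.bare_adj v (hI v hv) x hx _ hr.1 hr.2).2 w (hI w hw) (Ne.symm hv0) ?_
      rwa [heq]
    · simp only [if_neg hv0, if_neg hw0] at heq
      obtain ⟨rfl, rfl⟩ := h.shift_injective he hJ hJc (hmemJ v hv hv0) hx (hmemJ w hw hw0) hy heq
      rfl
  -- The tails are traced towards `v₀`, which differs from every leaf outside `I`.
  let Q : Finset (V × ℕ) := ((leaves T).toFinset \ I) ×ˢ Finset.range l
  let Ψ : V × ℕ → V := fun q => toward T v₀ q.2 q.1
  have hQmem : ∀ q ∈ Q, q.1 ∈ leaves T ∧ q.1 ∉ I ∧ q.2 < l := by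
    intro q hq
    simpa [Q, and_assoc] using hq
  have hQcard : Q.card = ((leaves T).ncard - I.card) * l := by
    rw [Finset.card_product, Finset.card_range, Finset.card_sdiff_of_subset,
      Set.ncard_eq_toFinset_card']
    intro v hv
    simpa using hI v hv
  have hΨinj : Set.InjOn Ψ Q := by
    rintro ⟨u, t⟩ hp ⟨w, s⟩ hq heq
    obtain ⟨hu, huI, ht⟩ := hQmem _ hp
    obtain ⟨hw, hwI, hs⟩ := hQmem _ hq
    simp only [Ψ] at heq hu huI ht hw hwI hs
    have hu0 : v₀ ≠ u := fun he => huI (he ▸ hv₀)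
    have hw0 : v₀ ≠ w := fun he => hwI (he ▸ hv₀)
    by_cases huw : u = w
    · subst huw
      rcases lt_trichotomy t s with hts | rfl | hts
      · exact absurd heq (h.tail_injective hu h₀L hu0 hts hs)
      · rfl
      · exact absurd heq.symm (h.tail_injective hu h₀L hu0 hts ht)
    · exact absurd heq (h.tail_disjoint hu hw h₀L hu0 hw0 huw t ht s hs)
  have hdisj : Disjoint (P.image Φ) (Q.image Ψ) := by
    rw [Finset.disjoint_left]
    intro z hz hz'
    obtain ⟨⟨v, x⟩, hp, rfl⟩ := Finset.mem_image.1 hz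
    obtain ⟨⟨u, t⟩, hq, heq⟩ := Finset.mem_image.1 hz'
    obtain ⟨hv, hx⟩ := hPmem _ hp
    obtain ⟨hu, huI, ht⟩ := hQmem _ hq
    have hu0 : v₀ ≠ u := fun he => huI (he ▸ hv₀)
    have huv : v ≠ u := fun he => huI (he ▸ hv)
    exact h.toward_ne_tail hu h₀L hu0 (hI v hv) huv hx t ht _ heq.symm
  have h₀ : v₀ ∉ P.image Φ ∪ Q.image Ψ := by
    rw [Finset.mem_union, Finset.mem_image, Finset.mem_image]
    rintro (⟨⟨v, x⟩, hp, heq⟩ | ⟨⟨u, t⟩, hq, heq⟩)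
    · obtain ⟨hv, hx⟩ := hPmem _ hp
      simp only [Φ, shift] at heq hv hx
      by_cases hv0 : v = v₀
      · subst hv0
        simp only [if_true, toward_zero] at heq
        exact hx.ne heq.symm
      · simp only [if_neg hv0] at heq
        have hvL := hI v hv
        obtain ⟨s, hs⟩ : ∃ s, rank T e J x v = s + 1 :=
          ⟨rank T e J x v - 1, by have := (hrank v (hmemJ v hv hv0) x).1; omega⟩
        rw [hs] at heq
        have hend := h.tree.toward_eq_of_mem_leaves (h.tree.leaves_subset hvL)
          (h.mem v hvL x hx) (n := s) (by rw [heq]; exact h₀L)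
        exact hv0 (hend.symm.trans heq)
    · obtain ⟨hu, huI, ht⟩ := hQmem _ hq
      have hu0 : v₀ ≠ u := fun he => huI (he ▸ hv₀)
      exact ((h.bare u hu v₀ h₀L hu0 t ht).2 v₀ h₀L hu0).1 heq.symm
  have hsub : insert v₀ (P.image Φ ∪ Q.image Ψ) ⊆ S.toFinset := by
    intro z hz
    rw [Set.mem_toFinset]
    rw [Finset.mem_insert, Finset.mem_union, Finset.mem_image, Finset.mem_image] at hz
    rcases hz with rfl | ⟨⟨v, x⟩, hp, rfl⟩ | ⟨⟨u, t⟩, hq, rfl⟩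
    · exact h₀S
    · obtain ⟨hv, hx⟩ := hPmem _ hp
      exact h.tree.toward_mem (h.tree.leaves_subset (hI v hv)) (h.mem v (hI v hv) x hx) _
    · exact h.tree.toward_mem h₀S (h.tree.leaves_subset (hQmem _ hq).1) _
  have hle := Finset.card_le_card hsub
  rw [Finset.card_insert_of_notMem h₀, Finset.card_union_of_disjoint hdisj,
    Finset.card_image_of_injOn hΦinj, Finset.card_image_of_injOn hΨinj, hPcard, hQcard,
    ← Set.ncard_eq_toFinset_card', mul_comm] at hle
  omega

end Count

/-! ### The inequality -/

section Main

variable {V : Type*} [Finite V] {G T : SimpleGraph V} {S : Set V} {k l : ℕ}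

/-- The neighbours of the leaves of a largest `(k+1)`-ended tree belong to the tree. -/
lemma IsTreeOn.mem_of_adj_leaf (hT : IsTreeOn T S) (hTG : T ≤ G)
    (hL : (leaves T).ncard ≤ k + 1) (hS : t G (k + 1) ≤ S.ncard) {v x : V} (hv : v ∈ leaves T)
    (hx : G.Adj v x) : x ∈ S := by
  by_contra hxS
  have h1 := (hT.isTreeOn_addEdge (hT.leaves_subset hv) hxS).ncard_le_t (k := k + 1)
    (addEdge_le hTG hx) (((Set.ncard_le_ncard (leaves_addEdge_subset hT hv hxS)
      (Set.toFinite _)).trans (ncard_insert_diff_le hv)).trans hL)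
  rw [Set.ncard_insert_of_notMem hxS] at h1
  omega

lemma isRigid_of_extremal (hk : 1 ≤ k) (hl : 1 ≤ l) (hT : IsTreeOn T S) (hTG : T ≤ G)
    (hL : (leaves T).ncard ≤ k + 1) (hS : S.ncard = t G (k + 1)) (ht : t G k + l ≤ t G (k + 1)) :
    IsRigid G T S l where
  tree := hT
  indep u hu v hv h := by
    have := hT.ncard_le_t_of_adj_leaves hk hTG hL hu hv h
    omega
  mem v hv x hx := hT.mem_of_adj_leaf hTG hL hS.ge hv hx
  bare u hu v hv hvu s hs := hT.bare_iterate hk hTG hL hu hv hvu (by omega)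
  bare_adj v hv x hx r hr hrl := by
    obtain ⟨r, rfl⟩ : ∃ r', r = r' + 1 := ⟨r - 1, by omega⟩
    refine hT.bare_iterate_of_adj hk hTG hL hv ?_ ?_ hx (l := l) (by omega) (by omega)
    · exact hT.mem_of_adj_leaf hTG hL hS.ge hv hx
    · intro hxL
      have := hT.ncard_le_t_of_adj_leaves hk hTG hL hv hxL hx
      omega

theorem lt_t_add_of_sigma {m : ℕ} [Nonempty V] (G : SimpleGraph V) (hk : 1 ≤ k) (hl : 1 ≤ l)
    (hm : 1 ≤ m) (hmk : m ≤ k + 1) (hml : m ≤ l + 1)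
    (hσ : (t G (k + 1) : ℕ∞) ≤ sigma G m + ((l * (k + 1 - m) : ℕ) : ℕ∞)) :
    t G (k + 1) < t G k + l := by
  by_contra! hlt
  obtain ⟨H, hH, hcard⟩ := (t_isGreatest G (k + 1)).1
  have hH : H.coe.IsTree ∧ (endVertices H).ncard ≤ k + 1 :=
    hH.resolve_right fun h => by have := h.1; omega
  have hT := isTreeOn_spanningCoe H hH.1
  have hTG := H.spanningCoe_le
  have hends : endVertices H = leaves H.spanningCoe := by
    ext v
    exact ⟨fun h => h.2, fun h => ⟨hT.leaves_subset h, h⟩⟩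
  have hL := hH.2
  rw [hends] at hL
  have hR := isRigid_of_extremal hk hl hT hTG hL hcard hlt
  -- With at most `k` leaves the tree would give `t G (k + 1) ≤ t G k`, contrary to `l ≥ 1`.
  have hLc : (leaves H.spanningCoe).ncard = k + 1 := by
    by_contra hc
    have := hT.ncard_le_t (k := k) hTG (by omega)
    omega
  obtain ⟨I, hIL, hIm⟩ := Set.exists_subset_card_eq (hmk.trans hLc.ge)
  have := Fintype.ofFinite V
  classical
  have hc := hR.sum_deg_add_le (I := I.toFinset) (fun v hv => hIL (Set.mem_toFinset.1 hv))
  rw [← Set.ncard_eq_toFinset_card', hIm, hLc, hcard] at hc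
  have hne : I.toFinset.Nonempty := by
    rw [Set.toFinset_nonempty]
    exact (Set.ncard_pos (Set.toFinite _)).1 (by omega)
  have hc := hc hne hml
  have hind : G.IsNIndepSet m I.toFinset := by
    refine ⟨?_, ?_⟩
    · intro u hu v hv _
      rw [Set.coe_toFinset] at hu hv
      exact hR.indep u (hIL hu) v (hIL hv)
    · rw [← Set.ncard_eq_toFinset_card', hIm]
  have hle : sigma G m ≤ ((∑ v ∈ I.toFinset, deg G v : ℕ) : ℕ∞) := iInf₂_le _ hind
  have h2 := hσ.trans (add_le_add_left hle _)
  have h3 : t G (k + 1) ≤ ∑ v ∈ I.toFinset, deg G v + l * (k + 1 - m) := by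
    exact_mod_cast h2
  omega

end Main

/-! ### The extremal graphs -/

section Example

variable {p q : ℕ}

lemma cliquesPlusVertex_adj_none (a : Fin p × Fin q) :
    (cliquesPlusVertex p q).Adj (some a) none := by
  refine ⟨by simp, fun _ b _ h => ?_⟩
  simp at h

lemma cliquesPlusVertex_adj_some {a b : Fin p × Fin q} :
    (cliquesPlusVertex p q).Adj (some a) (some b) ↔ a ≠ b ∧ a.1 = b.1 := by
  constructor
  · rintro ⟨h1, h2⟩
    exact ⟨fun h => h1 (congrArg some h), h2 a b rfl rfl⟩
  · rintro ⟨h1, h2⟩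
    refine ⟨fun h => h1 (Option.some.inj h), fun c d hc hd => ?_⟩
    rw [← Option.some.inj hc, ← Option.some.inj hd]
    exact h2

lemma cliquesPlusVertex_connected (p q : ℕ) : (cliquesPlusVertex p q).Connected := by
  have key : ∀ x, (cliquesPlusVertex p q).Reachable x none := by
    rintro (_ | a)
    · rfl
    · exact (cliquesPlusVertex_adj_none a).reachable
  exact ⟨fun x y => (key x).trans (key y).symm⟩

lemma card_cliquesPlusVertex (p q : ℕ) : Nat.card (Option (Fin p × Fin q)) = p * q + 1 := by
  simp

lemma t_cliquesPlusVertex_le (p q k : ℕ) : t (cliquesPlusVertex p q) k ≤ p * q + 1 := by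
  obtain ⟨H, -, hH⟩ := (t_isGreatest (cliquesPlusVertex p q) k).1
  rw [← hH, ← card_cliquesPlusVertex]
  exact Set.ncard_le_card _

lemma le_deg_cliquesPlusVertex (hp : 1 ≤ p) (v : Option (Fin p × Fin q)) :
    q ≤ deg (cliquesPlusVertex p q) v := by
  obtain ⟨f, hf, hfv⟩ : ∃ f : Fin q → Option (Fin p × Fin q), Function.Injective f ∧
      ∀ j, (cliquesPlusVertex p q).Adj v (f j) := by
    rcases v with _ | ⟨i, x⟩
    · refine ⟨fun j => some (⟨0, hp⟩, j), fun j j' h => by simpa using h, fun j => ?_⟩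
      exact (cliquesPlusVertex_adj_none _).symm
    · refine ⟨fun j => if j = x then none else some (i, j), fun j j' h => ?_, fun j => ?_⟩
      · by_cases h1 : j = x <;> by_cases h2 : j' = x <;> simp_all
      · by_cases h1 : j = x
        · simp only [if_pos h1]
          exact cliquesPlusVertex_adj_none _
        · simp only [if_neg h1]
          refine cliquesPlusVertex_adj_some.2 ⟨fun h => h1 ?_, rfl⟩
          rw [Prod.mk.injEq] at h
          exact h.2.symm
  have h1 : Set.range f ⊆ (cliquesPlusVertex p q).neighborSet v := by
    rintro _ ⟨j, rfl⟩
    exact hfv j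
  have h2 := Set.ncard_le_ncard h1 (Set.toFinite _)
  rw [← Set.image_univ, Set.ncard_image_of_injective _ hf, Set.ncard_univ] at h2
  simpa [deg] using h2

lemma le_sigma_cliquesPlusVertex (hp : 1 ≤ p) (m : ℕ) :
    ((m * q : ℕ) : ℕ∞) ≤ sigma (cliquesPlusVertex p q) m := by
  refine le_iInf₂ fun S hS => ?_
  rw [← hS.card_eq, ← smul_eq_mul]
  exact_mod_cast Finset.card_nsmul_le_sum S _ q fun v _ => le_deg_cliquesPlusVertex hp v

/-- The next vertex towards the centre in a spider whose legs are paths through the cliques. -/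
def spiderParent (a : Fin p × Fin q) : Option (Fin p × Fin q) :=
  if (a.2 : ℕ) = 0 then none else some (a.1, ⟨a.2 - 1, by omega⟩)

/-- A spider that spans `cliquesPlusVertex p q`. -/
def spider (p q : ℕ) : SimpleGraph (Option (Fin p × Fin q)) where
  Adj u v := (∃ a, u = some a ∧ v = spiderParent a) ∨ ∃ a, v = some a ∧ u = spiderParent a
  symm := ⟨fun _ _ h => h.symm⟩
  loopless := ⟨by
    have key : ∀ a : Fin p × Fin q, spiderParent a ≠ some a := by
      intro a ha
      unfold spiderParent at ha
      split at ha
      · simp at ha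
      · have := congrArg (fun b => (b.2 : ℕ)) (Option.some.inj ha)
        simp only at this
        omega
    rintro _ (⟨a, rfl, h⟩ | ⟨a, rfl, h⟩) <;> exact key a h.symm⟩

lemma spider_adj_parent (a : Fin p × Fin q) : (spider p q).Adj (some a) (spiderParent a) :=
  Or.inl ⟨a, rfl, rfl⟩

lemma spider_le : spider p q ≤ cliquesPlusVertex p q := by
  have key : ∀ a : Fin p × Fin q, (cliquesPlusVertex p q).Adj (some a) (spiderParent a) := by
    intro a
    unfold spiderParent
    split
    · exact cliquesPlusVertex_adj_none a
    · refine cliquesPlusVertex_adj_some.2 ⟨fun h => ?_, rfl⟩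
      have := congrArg (fun b => (b.2 : ℕ)) h
      simp only at this
      omega
  rintro u v (⟨a, rfl, rfl⟩ | ⟨a, rfl, rfl⟩)
  · exact key a
  · exact (key a).symm

/-- Connectedness is clear, and each edge is the parent edge of a non-central vertex, so there are
at most `p * q` edges. -/
lemma spider_isTree : (spider p q).IsTree := by
  have hreach : ∀ (n : ℕ) (i : Fin p) (hn : n < q),
      (spider p q).Reachable (some (i, ⟨n, hn⟩)) none := by
    intro n
    induction n with
    | zero =>
      intro i hn
      have := spider_adj_parent (i, (⟨0, hn⟩ : Fin q))
      simp only [spiderParent, if_true] at this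
      exact this.reachable
    | succ n ih =>
      intro i hn
      have := spider_adj_parent (i, (⟨n + 1, hn⟩ : Fin q))
      simp only [spiderParent, Nat.add_one_ne_zero, if_false, Nat.add_sub_cancel] at this
      exact this.reachable.trans (ih i (by omega))
  have key : ∀ x, (spider p q).Reachable x none := by
    rintro (_ | ⟨i, x⟩)
    · rfl
    · exact hreach x i x.2
  have hconn : (spider p q).Connected := ⟨fun x y => (key x).trans (key y).symm⟩
  rw [isTree_iff_connected_and_card]
  refine ⟨hconn, le_antisymm ?_ hconn.card_vert_le_card_edgeSet_add_one⟩
  have h1 : (spider p q).edgeSet ⊆ Set.range fun a => s(some a, spiderParent a) := by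
    intro e
    induction e using Sym2.ind with
    | _ u v =>
      rintro (⟨a, rfl, rfl⟩ | ⟨a, rfl, rfl⟩)
      · exact ⟨a, rfl⟩
      · exact ⟨a, Sym2.eq_swap⟩
  have h2 := Set.ncard_le_ncard h1 (Set.toFinite _)
  have h3 := Set.ncard_image_le (s := Set.univ) (f := fun a : Fin p × Fin q =>
    s(some a, spiderParent a)) (Set.toFinite _)
  rw [Set.image_univ, Set.ncard_univ] at h3
  rw [card_cliquesPlusVertex]
  have h4 : Nat.card (Fin p × Fin q) = p * q := by simp
  have h5 : Nat.card (spider p q).edgeSet = (spider p q).edgeSet.ncard := rfl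
  omega

lemma leaves_spider_ncard_le (hp : 2 ≤ p) : (leaves (spider p q)).ncard ≤ p := by
  have key : ∀ v ∈ leaves (spider p q), ∃ a, v = some a ∧ (a.2 : ℕ) + 1 = q := by
    rintro (_ | ⟨i, x⟩) hv
    · exfalso
      obtain ⟨w, ⟨a, h, -⟩ | ⟨a, -, -⟩⟩ := exists_adj_of_mem_leaves hv
      · simp at h
      · have hq : 0 < q := by have := a.2.2; omega
        have h0 := spider_adj_parent ((⟨0, by omega⟩ : Fin p), (⟨0, hq⟩ : Fin q))
        have h1 := spider_adj_parent ((⟨1, by omega⟩ : Fin p), (⟨0, hq⟩ : Fin q))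
        simp only [spiderParent, if_true] at h0 h1
        have := eq_of_mem_leaves hv h0.symm h1.symm
        simp at this
    · refine ⟨(i, x), rfl, ?_⟩
      by_contra hne
      have hx : (x : ℕ) + 1 < q := by have := x.2; simp only at hne; omega
      have h0 := spider_adj_parent (i, x)
      have h1 := spider_adj_parent (i, (⟨x + 1, hx⟩ : Fin q))
      simp only [spiderParent, Nat.add_one_ne_zero, if_false, Nat.add_sub_cancel] at h1
      have h2 := eq_of_mem_leaves hv h0 h1.symm
      unfold spiderParent at h2
      split at h2
      · simp at h2
      · have := congrArg (fun b => (b.2 : ℕ)) (Option.some.inj h2)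
        simp only at this
        omega
  -- The value `none` only serves to define the map for `q = 0`, where there are no leaves.
  have hsub : leaves (spider p q) ⊆
      (fun b : Option (Fin p) => b.bind fun i => if h : 0 < q then
        some (i, (⟨q - 1, by omega⟩ : Fin q)) else none) '' Set.range some := by
    intro v hv
    obtain ⟨⟨i, x⟩, rfl, hx⟩ := key v hv
    refine ⟨some i, ⟨i, rfl⟩, ?_⟩
    have hq : 0 < q := by omega
    simp only [Option.bind_some, dif_pos hq]
    congr 2
    ext
    simp only at hx ⊢
    omega
  refine (Set.ncard_le_ncard hsub (Set.toFinite _)).trans ((Set.ncard_image_le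
    (Set.toFinite _)).trans ?_)
  rw [← Set.image_univ]
  refine (Set.ncard_image_le (Set.toFinite _)).trans ?_
  rw [Set.ncard_univ]
  simp

lemma t_cliquesPlusVertex_self (hp : 2 ≤ p) : t (cliquesPlusVertex p q) p = p * q + 1 := by
  refine le_antisymm (t_cliquesPlusVertex_le p q p) ?_
  have hT : IsTreeOn (spider p q) Set.univ :=
    ⟨⟨none, trivial⟩, fun _ _ _ => trivial, spider_isTree.isAcyclic,
      fun x _ y _ => spider_isTree.connected x y⟩
  have := hT.ncard_le_t spider_le (leaves_spider_ncard_le hp)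
  rwa [Set.ncard_univ, card_cliquesPlusVertex] at this

/-- A walk that avoids the central vertex before its end stays in one clique until then. -/
lemma support_subset_clique {u w : Option (Fin p × Fin q)} (c : (cliquesPlusVertex p q).Walk u w) :
    ∀ a, u = some a → (c.IsPath ∧ w = none) ∨ none ∉ c.support →
      ∀ b, some b ∈ c.support → b.1 = a.1 := by
  induction c with
  | nil =>
    rintro a rfl _ b hb
    simp only [Walk.support_nil, List.mem_singleton, Option.some.injEq] at hb
    rw [hb]
  | @cons u v w h c ih =>
    rintro a rfl hc b hb
    rw [Walk.support_cons, List.mem_cons] at hb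
    rcases hb with hb | hb
    · rw [Option.some.inj hb]
    have hc' : (c.IsPath ∧ w = none) ∨ none ∉ c.support := by
      rcases hc with hc | hc
      · exact Or.inl ⟨hc.1.of_cons, hc.2⟩
      · rw [Walk.support_cons, List.mem_cons, not_or] at hc
        exact Or.inr hc.2
    rcases v with _ | d
    · rcases hc' with ⟨h1, rfl⟩ | h1
      · have h2 := (Walk.isPath_iff_nil.1 h1).eq_nil
        subst h2
        simp at hb
      · exact absurd c.start_mem_support h1
    · rw [ih d rfl hc' b hb]
      exact (cliquesPlusVertex_adj_some.1 h).2.symm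

lemma ncard_le_of_forall_some_notMem {k : ℕ} {S : Set (Option (Fin (k + 1) × Fin q))}
    (i : Fin (k + 1)) (h : ∀ x, some (i, x) ∉ S) : S.ncard ≤ k * q + 1 := by
  have hdisj : Disjoint S (Set.range fun x : Fin q => some (i, x)) := by
    rw [Set.disjoint_left]
    rintro _ hz ⟨x, rfl⟩
    exact h x hz
  have h1 := Set.ncard_union_eq hdisj (Set.toFinite _) (Set.toFinite _)
  have h2 : (Set.range fun x : Fin q => some (i, x)).ncard = q := by
    rw [← Set.image_univ, Set.ncard_image_of_injective, Set.ncard_univ]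
    · simp
    · intro x y hxy
      simpa using hxy
  have h3 := Set.ncard_le_card (S ∪ Set.range fun x : Fin q => some (i, x))
  rw [card_cliquesPlusVertex] at h3
  have h4 : (k + 1) * q = k * q + q := by ring
  omega

/-- A tree that contains the central vertex has a leaf in each clique that it meets. -/
lemma exists_leaf_in_clique {T : SimpleGraph (Option (Fin p × Fin q))}
    {S : Set (Option (Fin p × Fin q))} (hT : IsTreeOn T S) (hTG : T ≤ cliquesPlusVertex p q)
    (h0 : none ∈ S) (i : Fin p) (hi : ∃ x, some (i, x) ∈ S) :
    ∃ x, some (i, x) ∈ leaves T := by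
  -- A vertex of the clique farthest from the centre in `T` is a leaf: a neighbour further out would
  -- be in the same clique.
  obtain ⟨z, ⟨x, rfl, hxS⟩, hmax⟩ := Set.exists_max_image
    {z | ∃ x, z = some (i, x) ∧ some (i, x) ∈ S} (fun z => T.dist z none) (Set.toFinite _)
    (hi.elim fun x hx => ⟨_, x, rfl, hx⟩)
  refine ⟨x, mem_leaves_of (hT.adj_nxt hxS h0 (by simp)) fun b hb => ?_⟩
  rcases hT.nxt_eq_or h0 hb with h | h
  · exact h.symm
  · exfalso
    have hlt := hT.dist_lt_of_nxt_eq h0 hb.symm h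
    rcases b with _ | ⟨j, y⟩
    · rw [nxt_self] at h
      simp at h
    · obtain rfl : i = j := (cliquesPlusVertex_adj_some.1 (hTG hb)).2
      have := hmax (some (i, y)) ⟨y, rfl, hT.mem_right hb⟩
      omega

lemma none_mem_of_isTreeOn {T : SimpleGraph (Option (Fin p × Fin q))}
    {S : Set (Option (Fin p × Fin q))} (hT : IsTreeOn T S) (hTG : T ≤ cliquesPlusVertex p q)
    {a b : Fin p × Fin q} (ha : some a ∈ S) (hb : some b ∈ S) (hab : a.1 ≠ b.1) : none ∈ S := by
  by_contra h0
  have hsub : S ⊆ {z | ∃ c, z = some c ∧ c.1 = a.1} := by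
    refine subset_of_adj_closed hT ha ⟨a, rfl, rfl⟩ ?_
    rintro _ ⟨c, rfl, hc⟩ z hz
    rcases z with _ | d
    · exact absurd (hT.mem_right hz) h0
    · exact ⟨d, rfl, (cliquesPlusVertex_adj_some.1 (hTG hz)).2.symm.trans hc⟩
  obtain ⟨c, hc, hca⟩ := hsub hb
  rw [Option.some.inj hc] at hab
  exact hab hca.symm

lemma exists_clique_disjoint_cycle {v : Option (Fin 2 × Fin q)}
    (c : (cliquesPlusVertex 2 q).Walk v v) (hc : c.IsCycle) :
    ∃ i, ∀ x, some (i, x) ∉ c.toSubgraph.verts := by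
  have hother : ∀ j : Fin 2, ∃ i, i ≠ j := fun j => exists_ne j
  by_cases h0 : none ∈ c.support
  -- Started at the centre, the cycle is one edge followed by a path back to the centre, which stays
  -- in one clique until its end.
  · have hr := hc.rotate h0
    rw [← Walk.toSubgraph_rotate c h0]
    generalize c.rotate none h0 = c' at hr
    cases c' with
    | nil => exact absurd rfl hr.ne_nil
    | @cons _ w _ h d =>
      rw [Walk.cons_isCycle_iff] at hr
      rcases w with _ | a
      · exact absurd rfl h.ne
      · obtain ⟨i, hi⟩ := hother a.1
        refine ⟨i, fun x hx => hi ?_⟩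
        rw [Walk.mem_verts_toSubgraph, Walk.support_cons, List.mem_cons] at hx
        exact support_subset_clique d a rfl (Or.inl ⟨hr.1, rfl⟩) _ (hx.resolve_left (by simp))
  · rcases v with _ | a
    · exact absurd c.start_mem_support h0
    · obtain ⟨i, hi⟩ := hother a.1
      refine ⟨i, fun x hx => hi ?_⟩
      rw [Walk.mem_verts_toSubgraph] at hx
      exact support_subset_clique c a rfl (Or.inr h0) _ hx

/-- More than `k * q + 1` vertices meet all `k + 1` cliques. A tree that does so contains the centre
and has a leaf in each clique, which is one leaf too many; a cycle cannot meet two cliques fully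
separated by the centre. -/
lemma t_cliquesPlusVertex_succ_le {k : ℕ} (hk : 1 ≤ k) (q : ℕ) :
    t (cliquesPlusVertex (k + 1) q) k ≤ k * q + 1 := by
  rcases Nat.eq_zero_or_pos q with rfl | hq
  · simpa using t_cliquesPlusVertex_le (k + 1) 0 k
  obtain ⟨H, hH, hcard⟩ := (t_isGreatest (cliquesPlusVertex (k + 1) q) k).1
  rw [← hcard]
  rcases hH with ⟨htree, hends⟩ | ⟨rfl, hcyc⟩
  · have hT := isTreeOn_spanningCoe H htree
    have hTG := H.spanningCoe_le
    by_contra hlt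
    have hmeet : ∀ i, ∃ x, some (i, x) ∈ H.verts := by
      intro i
      by_contra! hc
      exact hlt (ncard_le_of_forall_some_notMem i hc)
    obtain ⟨x, hx⟩ := hmeet ⟨0, by omega⟩
    obtain ⟨y, hy⟩ := hmeet ⟨1, by omega⟩
    have h0 := none_mem_of_isTreeOn hT hTG hx hy (by simp)
    choose f hf using fun i => exists_leaf_in_clique hT hTG h0 i (hmeet i)
    have hsub : Set.range (fun i => some (i, f i)) ⊆ endVertices H := by
      rintro _ ⟨i, rfl⟩
      exact ⟨hT.leaves_subset (hf i), hf i⟩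
    have h1 := Set.ncard_le_ncard hsub (Set.toFinite _)
    rw [← Set.image_univ, Set.ncard_image_of_injective, Set.ncard_univ] at h1
    · simp only [Nat.card_eq_fintype_card, Fintype.card_fin] at h1
      omega
    · intro i j hij
      simp only [Option.some.injEq, Prod.mk.injEq] at hij
      exact hij.1
  · rcases hcyc with ⟨v, rfl⟩ | ⟨u, v, h, rfl⟩ | ⟨v, c, hc, rfl⟩
    · simp
    · have : ((cliquesPlusVertex (1 + 1) q).subgraphOfAdj h).verts = {u, v} := rfl
      rw [this, Set.ncard_pair h.ne]
      omega
    · obtain ⟨i, hi⟩ := exists_clique_disjoint_cycle c hc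
      exact ncard_le_of_forall_some_notMem i hi

end Example

end KEndedTrees

theorem theorem3 (k l m : ℕ) (hk : 1 ≤ k) (hl : 1 ≤ l) (hm : 1 ≤ m) (hmin : m ≤ min k l + 1) :
    -- the theorem; the hypothesis reads `σ_m ≥ t_{k+1} - l (k - m + 1)`, where `m ≤ k + 1`
    (∀ (V : Type*) [Finite V] (G : SimpleGraph V), G.Connected →
      KEndedTrees.sigma G m + ((l * (k + 1 - m) : ℕ) : ℕ∞) ≥ (KEndedTrees.t G (k + 1) : ℕ∞) →
      (KEndedTrees.t G k : ℤ) ≥ (KEndedTrees.t G (k + 1) : ℤ) - l + 1) ∧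
    -- `G₁ = (k+1) K_l + K_1`: the hypothesis cannot be relaxed by one
    ((KEndedTrees.cliquesPlusVertex (k + 1) l).Connected ∧
      KEndedTrees.sigma (KEndedTrees.cliquesPlusVertex (k + 1) l) m
          + ((l * (k + 1 - m) : ℕ) : ℕ∞) + 1
        ≥ (KEndedTrees.t (KEndedTrees.cliquesPlusVertex (k + 1) l) (k + 1) : ℕ∞) ∧
      ¬ (KEndedTrees.t (KEndedTrees.cliquesPlusVertex (k + 1) l) k : ℤ) ≥
        (KEndedTrees.t (KEndedTrees.cliquesPlusVertex (k + 1) l) (k + 1) : ℤ) - l + 1) ∧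
    -- `G₂ = (k+1) K_{l-1} + K_1`: the conclusion cannot be strengthened by one when `m ≤ k`
    (m ≤ k →
      (KEndedTrees.cliquesPlusVertex (k + 1) (l - 1)).Connected ∧
      KEndedTrees.sigma (KEndedTrees.cliquesPlusVertex (k + 1) (l - 1)) m
          + ((l * (k + 1 - m) : ℕ) : ℕ∞)
        ≥ (KEndedTrees.t (KEndedTrees.cliquesPlusVertex (k + 1) (l - 1)) (k + 1) : ℕ∞) ∧
      ¬ (KEndedTrees.t (KEndedTrees.cliquesPlusVertex (k + 1) (l - 1)) k : ℤ) ≥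
        (KEndedTrees.t (KEndedTrees.cliquesPlusVertex (k + 1) (l - 1)) (k + 1) : ℤ) - l + 2) := by

  have hmk : m ≤ k + 1 := by omega
  have hml : m ≤ l + 1 := by omega
  refine ⟨fun V _ G hG hσ => ?_, ⟨KEndedTrees.cliquesPlusVertex_connected _ _, ?_, ?_⟩,
    fun hmk' => ⟨KEndedTrees.cliquesPlusVertex_connected _ _, ?_, ?_⟩⟩
  · have := hG.nonempty
    have := KEndedTrees.lt_t_add_of_sigma G hk hl hm hmk hml hσ
    omega
  · rw [KEndedTrees.t_cliquesPlusVertex_self (by omega), ge_iff_le]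
    have h := KEndedTrees.le_sigma_cliquesPlusVertex (p := k + 1) (q := l) (by omega) m
    refine le_trans ?_ (add_le_add_left (add_le_add_left h _) _)
    obtain ⟨d, hd⟩ := Nat.exists_eq_add_of_le hmk
    rw [hd, Nat.add_sub_cancel_left]
    exact_mod_cast (show (m + d) * l + 1 ≤ m * l + l * d + 1 by nlinarith)
  · rw [KEndedTrees.t_cliquesPlusVertex_self (by omega)]
    have h := KEndedTrees.t_cliquesPlusVertex_succ_le hk l
    have h' : (k + 1) * l = k * l + l := by ring
    omega
  · rw [KEndedTrees.t_cliquesPlusVertex_self (by omega), ge_iff_le]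
    have h := KEndedTrees.le_sigma_cliquesPlusVertex (p := k + 1) (q := l - 1) (by omega) m
    refine le_trans ?_ (add_le_add_left h _)
    obtain ⟨d, hd⟩ := Nat.exists_eq_add_of_le hmk'
    obtain ⟨n, rfl⟩ := Nat.exists_eq_add_of_le' hl
    rw [hd, Nat.add_sub_cancel, show m + d + 1 - m = d + 1 by omega]
    -- The two sides differ by `d = k - m`, which is where `m ≤ k` enters.
    exact_mod_cast (show (m + d + 1) * n + 1 ≤ m * n + (n + 1) * (d + 1) by nlinarith)
  · rw [KEndedTrees.t_cliquesPlusVertex_self (by omega)]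
    have h := KEndedTrees.t_cliquesPlusVertex_succ_le hk (l - 1)
    have h' : (k + 1) * (l - 1) = k * (l - 1) + (l - 1) := by ring
    omega
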